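/- Let $\mathfrak m$ be an infinite, connected, locally finite rooted planar map with one end, all of whose faces have finite degree. Let $\mathfrak m^\dagger$ be its dual map, whose origin is the root face $f_{\mathrm r}$ (the face on the right of the root edge). Let $(x_e)$ be i.i.d. $\mathrm{Exp}(1)$ weights on the edges of $\mathfrak m^\dagger$, let $d_{\mathrm{fpp}}$ be the corresponding first-passage percolation distance, and extend it to $\mathfrak m^\dagger$ viewed as a metric graph in which $e$ is a segment of length $x_e$. A submap $\mathfrak e$ of $\mathfrak m$ is described by its set $\mathfrak e^\circ$ of explored dual edges. Its faces are the root face and the faces incident to $\mathfrak e^\circ$. Its boundary edges are the sides, in these faces, of the edges of $\mathfrak m$ not in $\mathfrak e^\circ$ (so an unexplored edge with explored faces on both sides gives two boundary edges). Its perimeter is the number of its boundary edges. The hull of $\mathfrak e$ is obtained by adding to $\mathfrak e^\circ$ all edges in finite connected components of the graph $\mathfrak m$ deprived of the edges in $\mathfrak e^\circ$. Peeling a boundary edge of $\mathfrak e$ means adding the corresponding dual edge to $\mathfrak e^\circ$ and taking the hull. For $t\ge 0$ let $\mathrm{Ball}_t$ be the set of dual edges all of whose points are at distance at most $t$ from $f_{\mathrm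 r}$, and let $\overline{\mathrm{Ball}}_t$ be its hull. Put $t_0=0$, $t_{i+1}=\inf\{t>t_i:\overline{\mathrm{Ball}}_t\ne\overline{\mathrm{Ball}}_{t_i}\}$ and $\mathfrak e_i=\overline{\mathrm{Ball}}_{t_i}$. Then almost surely $0=t_0<t_1<t_2<\cdots<\infty$, and: 1. $(\mathfrak e_i)_{i\ge0}$ is a uniform peeling of $\mathfrak m$. That is, almost surely $\mathfrak e_0$ consists of the root face only, all $\mathfrak e_i$ are finite, and each $\mathfrak e_{i+1}$ is obtained from $\mathfrak e_i$ by peeling a boundary edge; and, for each $i$, conditionally on $\mathfrak e_0,\dots,\mathfrak e_i$, the submap $\mathfrak e_{i+1}$ is distributed as the result of peeling a uniformly chosen boundary edge of $\mathfrak e_i$. 2. Conditionally on the whole sequence $(\mathfrak e_i)_{i\ge 0}$, the variables $t_{i+1}-t_i$, $i\ge0$, are independent, and $t_{i+1}-t_i$ is exponential with parameter (rate) the perimeter of $\mathfrak e_i$. -/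

import Mathlib

open MeasureTheory ProbabilityTheory

/-- A connected rooted map on an oriented surface, as a rotation system on the set `D` of its
oriented edges (darts): `rot` turns a dart counterclockwise around its origin, `rev` reverses it.
Cycles of `rot`, `rev` and `rot * rev` are the vertices, the edges and the faces; the face of a dart
is the one lying on its right. Loops and multiple edges are allowed. -/
structure RootedMap (D : Type*) where
  rot : Equiv.Perm D
  rev : Equiv.Perm D
  rev_rev : ∀ d, rev (rev d) = d
  rev_ne : ∀ d, rev d ≠ d
  root : D
  connected : ∀ d d', ∃ g ∈ Subgroup.closure {rot, rev}, g d = d'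

namespace RootedMap

variable {D : Type*} (m : RootedMap D)

/-- Vertices of the map. -/
def Vertex : Type _ := Quotient (Equiv.Perm.SameCycle.setoid m.rot)

/-- Edges of the map; an edge is identified with its dual edge. -/
def Edge : Type _ := Quotient (Equiv.Perm.SameCycle.setoid m.rev)

/-- Faces of the map, i.e. vertices of the dual map. -/
def Face : Type _ := Quotient (Equiv.Perm.SameCycle.setoid (m.rot * m.rev))

/-- The origin of a dart. -/
def vert (d : D) : m.Vertex := Quotient.mk _ d

/-- The edge carrying a dart. -/
def edge (d : D) : m.Edge := Quotient.mk _ d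

/-- The face on the right of a dart. The dual of the edge of `d` joins `m.face d` to
`m.face (m.rev d)`. -/
def face (d : D) : m.Face := Quotient.mk _ d

/-- The face on the right of the root, which is the origin of the dual map. -/
def rootFace : m.Face := m.face m.root

/-- All vertices have finite degree and all faces have finite degree. -/
def LocallyFinite : Prop :=
  (∀ v : m.Vertex, {d | m.vert d = v}.Finite) ∧ ∀ f : m.Face, {d | m.face d = f}.Finite

/-! ### Planarity: every finite submap has genus zero -/

/-- Darts of the submap with edge set `S`. -/
def SubDart (S : Set m.Edge) : Type _ := {d : D // m.edge d ∈ S}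

/-- In the submap with edge set `S`, the dart `d'` is the first dart after `d` in counterclockwise
order around the origin of `d`. -/
def SubRot (S : Set m.Edge) (d d' : D) : Prop :=
  ∃ k : ℕ, 1 ≤ k ∧ (m.rot ^ k) d = d' ∧ m.edge d' ∈ S ∧
    ∀ j : ℕ, 1 ≤ j → j < k → m.edge ((m.rot ^ j) d) ∉ S

/-- Vertices of the submap with edge set `S`. -/
def SubVertex (S : Set m.Edge) : Type _ :=
  Quot fun a b : m.SubDart S => m.vert a.1 = m.vert b.1

/-- Faces of the submap with edge set `S` (those of each component counted separately). -/
def SubFace (S : Set m.Edge) : Type _ :=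
  Quot fun a b : m.SubDart S => m.SubRot S (m.rev a.1) b.1

/-- Connected components of the submap with edge set `S`. -/
def SubComponent (S : Set m.Edge) : Type _ :=
  Quot fun a b : m.SubDart S => m.vert a.1 = m.vert b.1 ∨ b.1 = m.rev a.1

/-- A map is planar if all its finite submaps satisfy Euler's formula `V - E + F = 2 C`. -/
def Planar : Prop :=
  ∀ S : Set m.Edge, S.Finite →
    Nat.card (m.SubVertex S) + Nat.card (m.SubFace S) =
      S.ncard + 2 * Nat.card (m.SubComponent S)

/-! ### Complements and hulls -/

/-- Two edges share a vertex. -/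
def Touch (a b : m.Edge) : Prop :=
  ∃ d d' : D, m.edge d = a ∧ m.edge d' = b ∧ m.vert d = m.vert d'

/-- The edges in the connected component of `e` in the graph of the map deprived of the edges in
`S` (meant for `e ∉ S`). -/
def component (S : Set m.Edge) (e : m.Edge) : Set m.Edge :=
  {e' | Relation.ReflTransGen (fun a b => a ∉ S ∧ b ∉ S ∧ m.Touch a b) e e'}

/-- After removal of any finite set of edges there is exactly one infinite component. -/
def OneEnded : Prop :=
  ∀ S : Set m.Edge, S.Finite →
    ∃ e ∉ S, (m.component S e).Infinite ∧
      ∀ e' ∉ S, (m.component S e').Infinite → e' ∈ m.component S e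

/-- Submaps are encoded by their set `S` of explored (dual) edges. In a planar map the holes
of the submap correspond to the components of the complement of `S` in the primal graph, all edges
on the boundary of a hole being in the same component. The hull fills in the finite ones. -/
def hull (S : Set m.Edge) : Set m.Edge :=
  S ∪ {e | e ∉ S ∧ (m.component S e).Finite}

/-- The faces that belong to the submap with explored edges `S`: the root face and those incident to
an explored edge. -/
def Explored (S : Set m.Edge) (f : m.Face) : Prop :=
  f = m.rootFace ∨ ∃ d, m.face d = f ∧ m.edge d ∈ S

/-- The boundary of the submap with explored edges `S`: the sides, in explored faces, of the
unexplored edges. An unexplored edge with an explored face on both sides gives two boundary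
edges. -/
def boundary (S : Set m.Edge) : Set D :=
  {d | m.edge d ∉ S ∧ m.Explored S (m.face d)}

/-- The number of boundary edges. -/
noncomputable def perimeter (S : Set m.Edge) : ℕ := (m.boundary S).ncard

/-- The submap obtained by peeling the boundary edge `d`, and filling in the finite hole possibly
created. -/
def peel (S : Set m.Edge) (d : D) : Set m.Edge := m.hull (insert (m.edge d) S)

/-! ### First-passage percolation on the dual map -/

/-- `m.IsDualPath f l g`: the dual edges crossed from right to left by the darts in the list `l`
form a path from `f` to `g` in the dual map. -/
def IsDualPath (f : m.Face) : List D → m.Face → Prop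
  | [], g => f = g
  | d :: l, g => m.face d = f ∧ IsDualPath (m.face (m.rev d)) l g

/-- First-passage percolation distance for the weights `w`. -/
noncomputable def fppDist (w : m.Edge → ℝ) (f g : m.Face) : ℝ :=
  sInf {s | ∃ l, m.IsDualPath f l g ∧ s = (l.map fun d => w (m.edge d)).sum}

/-- Viewing dual edges as segments whose lengths are the weights: the distance to the root face
of the point of the dual of the edge of `d` lying at distance `s` along it from `m.face d`. -/
noncomputable def pointDist (w : m.Edge → ℝ) (d : D) (s : ℝ) : ℝ :=
  min (m.fppDist w m.rootFace (m.face d) + s)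
    (m.fppDist w m.rootFace (m.face (m.rev d)) + (w (m.edge d) - s))

/-- The dual edges all of whose points are within distance `t` of the root face. -/
def fppBall (w : m.Edge → ℝ) (t : ℝ) : Set m.Edge :=
  {e | ∀ d, m.edge d = e → ∀ s ∈ Set.Icc 0 (w e), m.pointDist w d s ≤ t}

/-- The hull of the ball of radius `t`. -/
def fppHull (w : m.Edge → ℝ) (t : ℝ) : Set m.Edge := m.hull (m.fppBall w t)

/-- The successive jump times of `t ↦ m.fppHull w t`, started with `0`. -/
noncomputable def jumpTime (w : m.Edge → ℝ) : ℕ → ℝ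
  | 0 => 0
  | i + 1 => sInf {t | jumpTime w i < t ∧ m.fppHull w t ≠ m.fppHull w (jumpTime w i)}

/-- The hull at the `i`-th jump time. -/
noncomputable def jumpHull (w : m.Edge → ℝ) (i : ℕ) : Set m.Edge :=
  m.fppHull w (m.jumpTime w i)

/-! ### Peeling explorations -/

/-- A (deterministic) peeling exploration: start with the root face only, and at each step peel an
edge of the boundary. -/
def IsPeeling (E : ℕ → Set m.Edge) : Prop :=
  E 0 = ∅ ∧ ∀ i, ∃ d ∈ m.boundary (E i), E (i + 1) = m.peel (E i) d

/-- A random sequence `E` of submaps is a uniform peeling if it is almost surely a peeling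
exploration by finite submaps and if, given the past, `E (i + 1)` is distributed as the result of
peeling a uniformly chosen edge of the boundary of `E i`. As finite submaps form a countable set,
elementary conditioning on the past is enough. -/
def IsUniformPeeling {Ω : Type*} [MeasurableSpace Ω] (μ : Measure Ω)
    (E : ℕ → Ω → Set m.Edge) : Prop :=
  (∀ᵐ ω ∂μ, m.IsPeeling (fun i => E i ω) ∧ ∀ i, (E i ω).Finite) ∧
  ∀ (i : ℕ) (A : ℕ → Set m.Edge), μ {ω | ∀ j ≤ i, E j ω = A j} ≠ 0 →
    (m.boundary (A i)).Finite ∧ (m.boundary (A i)).Nonempty ∧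
    ∀ B : Set m.Edge,
      μ[|{ω | ∀ j ≤ i, E j ω = A j}] {ω | E (i + 1) ω = B} =
        ({d ∈ m.boundary (A i) | m.peel (A i) d = B}.ncard : ENNReal) / m.perimeter (A i)

end RootedMap

namespace RootedMap

variable {D : Type*} (m : RootedMap D)

/-! Let the exploration flow at unit speed along the dual edges from the root face. At a jump time
`T`, with current hull `A`, every boundary dart is an explored end of an unexplored dual edge, so an
edge `j` is consumed at speed `sides A j`, which is 0, 1 or 2. Let `r j` be its unexplored length.
The next edge to be completed is the `e` minimising `r e / sides A e`. The next hull is obtained by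
peeling `e`, the waiting time is this minimum, and the other residual lengths drop by speed times
waiting time.

This part is deterministic: for positive weights the invariant `IsState` links the residual lengths
to first-passage distances, and `IsState.next` propagates it whenever a strict minimiser exists. The
main point is that a face not yet explored cannot be reached before some edge outside the hull is
completed (`IsState.le_fppDist`).

The probabilistic part is a competition of exponential clocks. If the residual lengths outside `A`
are i.i.d. Exp(1), then `e` wins with probability `sides A e / perimeter A`, the waiting time is an
independent exponential variable of rate `perimeter A`, and by lack of memory the other residual
lengths are again i.i.d. Exp(1), independently of both (`law_first_clock`). Grouping edges by the
submap they produce turns the weights `sides A e` into a uniform choice among boundary darts.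
Iterating gives a product formula for finite trajectories (`LocallyFinite.law_trajectory`). Ratios
of these products give the uniform peeling. Since finite submaps are countably many, the same
formula identifies the joint law of hulls and durations with a product kernel over the law of the
hulls (`LocallyFinite.map_jumpHull_jumpGaps`), and uniqueness of conditional distributions
concludes. -/

lemma edge_rev (d : D) : m.edge (m.rev d) = m.edge d :=
  Quotient.sound (⟨-1, by simp⟩ : m.rev.SameCycle (m.rev d) d)

lemma edge_eq_iff {d d' : D} : m.edge d = m.edge d' ↔ d' = d ∨ d' = m.rev d := by
  refine ⟨fun h => ?_, ?_⟩
  · obtain ⟨k, hk⟩ : m.rev.SameCycle d d' := Quotient.exact h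
    have h2 : m.rev ^ 2 = 1 := by ext x; simp [pow_two, m.rev_rev]
    rcases Int.even_or_odd' k with ⟨l, rfl | rfl⟩
    · left; rw [← hk, zpow_mul, zpow_ofNat, h2]; simp
    · right; rw [← hk, zpow_add, zpow_mul, zpow_ofNat, h2]; simp
  · rintro (rfl | rfl)
    · rfl
    · rw [edge_rev]

/-! ### Darts, faces and countability -/

lemma vert_rot (d : D) : m.vert (m.rot d) = m.vert d :=
  Quotient.sound (⟨-1, by simp⟩ : m.rot.SameCycle (m.rot d) d)

lemma face_rot (d : D) : m.face (m.rot d) = m.face (m.rev d) :=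
  Quotient.sound (⟨-1, by
    rw [zpow_neg_one, Equiv.Perm.inv_eq_iff_eq]; simp [m.rev_rev]⟩ :
      (m.rot * m.rev).SameCycle (m.rot d) (m.rev d))

lemma exists_edge_eq (e : m.Edge) : ∃ d, m.edge d = e := Quotient.exists_rep e

lemma exists_face_eq (f : m.Face) : ∃ d, m.face d = f := Quotient.exists_rep f

/-- A set of darts containing the root and invariant under `rot` and `rev` contains all darts. -/
lemma forall_of_invariant {p : D → Prop} (hroot : p m.root)
    (hrot : ∀ d, p (m.rot d) ↔ p d) (hrev : ∀ d, p (m.rev d) ↔ p d) (d : D) : p d := by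
  obtain ⟨g, hg, rfl⟩ := m.connected m.root d
  have key : ∀ d, p (g d) ↔ p d := by
    induction hg using Subgroup.closure_induction with
    | mem x hx => rcases hx with rfl | rfl <;> assumption
    | one => simp
    | mul x y _ _ hx hy => intro d; rw [Equiv.Perm.mul_apply, hx, hy]
    | inv x _ hx => intro d; simpa using (hx (x⁻¹ d)).symm
  exact (key _).2 hroot

/-- By connectedness every dart is reached from the root by a finite word in `rev` (coded by
`none`), `rot` and its inverse (coded by `some true` and `some false`). -/
lemma countable_dart (m : RootedMap D) : Countable D := by
  let F : List (Option Bool) → D := fun l => l.foldr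
    (fun o d => o.elim (m.rev d) fun b => if b then m.rot d else m.rot.symm d) m.root
  refine Function.Surjective.countable (f := F) ?_
  refine m.forall_of_invariant (p := fun d => ∃ l, F l = d) ⟨[], rfl⟩ (fun d => ?_) (fun d => ?_)
  · refine ⟨fun ⟨l, hl⟩ => ⟨some false :: l, ?_⟩, fun ⟨l, hl⟩ => ⟨some true :: l, ?_⟩⟩
    · simp [F] at hl ⊢; simp [hl]
    · simp [F] at hl ⊢; simp [hl]
  · refine ⟨fun ⟨l, hl⟩ => ⟨none :: l, ?_⟩, fun ⟨l, hl⟩ => ⟨none :: l, ?_⟩⟩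
    · simp [F] at hl ⊢; simp [hl, m.rev_rev]
    · simp [F] at hl ⊢; simp [hl]

lemma countable_edge : Countable m.Edge :=
  have := m.countable_dart
  Function.Surjective.countable m.exists_edge_eq

lemma finite_setOf_edge_eq (e : m.Edge) : {d | m.edge d = e}.Finite := by
  obtain ⟨d, rfl⟩ := m.exists_edge_eq e
  refine (Set.toFinite {d, m.rev d}).subset fun d' h => ?_
  exact m.edge_eq_iff.1 h.symm

lemma infinite_edge [Infinite D] : Infinite m.Edge := by
  by_contra h
  rw [not_infinite_iff_finite] at h
  refine Set.infinite_univ (α := D) ?_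
  have : (⋃ e : m.Edge, {d | m.edge d = e}).Finite := Set.finite_iUnion m.finite_setOf_edge_eq
  exact this.subset fun d _ => by simp

/-! ### Hulls -/

lemma Touch.symm {a b : m.Edge} (h : m.Touch a b) : m.Touch b a := by
  obtain ⟨d, d', h1, h2, h3⟩ := h
  exact ⟨d', d, h2, h1, h3.symm⟩

lemma self_mem_component (S : Set m.Edge) (e : m.Edge) : e ∈ m.component S e :=
  Relation.ReflTransGen.refl

lemma component_symm {S : Set m.Edge} {e e' : m.Edge} (h : e' ∈ m.component S e) :
    e ∈ m.component S e' := by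
  have : Std.Symm fun a b => a ∉ S ∧ b ∉ S ∧ m.Touch a b :=
    ⟨fun a b hab => ⟨hab.2.1, hab.1, Touch.symm m hab.2.2⟩⟩
  exact Std.Symm.symm _ _ h

lemma component_eq {S : Set m.Edge} {e e' : m.Edge} (h : e' ∈ m.component S e) :
    m.component S e' = m.component S e := by
  ext x
  exact ⟨fun hx => Relation.ReflTransGen.trans h hx,
    fun hx => Relation.ReflTransGen.trans (m.component_symm h) hx⟩

lemma notMem_of_mem_component {S : Set m.Edge} {e e' : m.Edge} (he : e ∉ S)
    (h : e' ∈ m.component S e) : e' ∉ S := by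
  rcases Relation.ReflTransGen.cases_tail h with rfl | ⟨b, _, hb⟩
  · exact he
  · exact hb.2.1

lemma component_anti {S S' : Set m.Edge} (h : S ⊆ S') (e : m.Edge) :
    m.component S' e ⊆ m.component S e := by
  intro x hx
  exact Relation.ReflTransGen.mono
    (fun a b hab => ⟨fun h' => hab.1 (h h'), fun h' => hab.2.1 (h h'), hab.2.2⟩) _ _ hx

lemma subset_hull (S : Set m.Edge) : S ⊆ m.hull S := Set.subset_union_left

lemma hull_mono {S S' : Set m.Edge} (h : S ⊆ S') : m.hull S ⊆ m.hull S' := by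
  rintro e (he | ⟨he, hfin⟩)
  · exact m.subset_hull _ (h he)
  · by_cases he' : e ∈ S'
    · exact m.subset_hull _ he'
    · exact Or.inr ⟨he', hfin.subset (m.component_anti h e)⟩

/-- A component of the complement of `S` is either swallowed entirely or left untouched, so filling
creates no new finite component. -/
lemma hull_hull (S : Set m.Edge) : m.hull (m.hull S) = m.hull S := by
  refine (m.subset_hull _).antisymm' ?_
  rintro e (he | ⟨he, hfin⟩)
  · exact he
  have heS : e ∉ S := fun h => he (m.subset_hull _ h)
  refine Or.inr ⟨heS, hfin.subset fun x hx => ?_⟩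
  have key : ∀ y, y ∈ m.component S e → y ∉ m.hull S := by
    rintro y hy (hyS | ⟨_, hyfin⟩)
    · exact m.notMem_of_mem_component heS hy hyS
    · rw [m.component_eq hy] at hyfin
      exact he (Or.inr ⟨heS, hyfin⟩)
  induction hx with
  | refl => exact Relation.ReflTransGen.refl
  | tail hab hbc ih => exact Relation.ReflTransGen.tail ih ⟨key _ hab, key _ (hab.tail hbc), hbc.2.2⟩

lemma hull_eq_of_subset_of_subset {S S' : Set m.Edge} (h : S ⊆ S') (h' : S' ⊆ m.hull S) :
    m.hull S' = m.hull S :=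
  ((m.hull_mono h').trans_eq (m.hull_hull S)).antisymm (m.hull_mono h)

lemma hull_insert_hull (S : Set m.Edge) (e : m.Edge) :
    m.hull (insert e (m.hull S)) = m.hull (insert e S) :=
  m.hull_eq_of_subset_of_subset (Set.insert_subset_insert (m.subset_hull S))
    (Set.insert_subset (m.subset_hull _ (Set.mem_insert _ _))
      (m.hull_mono (Set.subset_insert _ _)))

/-- Any two edges are linked by a chain of touching edges. -/
lemma reflTransGen_touch (a b : m.Edge) : Relation.ReflTransGen m.Touch a b := by
  have key : ∀ d, Relation.ReflTransGen m.Touch (m.edge m.root) (m.edge d) := by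
    refine m.forall_of_invariant .refl (fun d => ?_) (fun d => by rw [edge_rev])
    have h : m.Touch (m.edge (m.rot d)) (m.edge d) := ⟨_, _, rfl, rfl, m.vert_rot d⟩
    exact ⟨fun h' => h'.tail h, fun h' => h'.tail (Touch.symm m h)⟩
  obtain ⟨d, rfl⟩ := m.exists_edge_eq a
  obtain ⟨d', rfl⟩ := m.exists_edge_eq b
  have : Std.Symm m.Touch := ⟨fun a b h => Touch.symm m h⟩
  exact (Std.Symm.symm _ _ (key d) : Relation.ReflTransGen m.Touch _ _).trans (key d')

lemma component_empty (e : m.Edge) : m.component ∅ e = Set.univ := by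
  refine Set.eq_univ_of_forall fun x => ?_
  exact Relation.ReflTransGen.mono (fun a b h => ⟨id, id, h⟩) _ _ (m.reflTransGen_touch e x)

lemma hull_empty [Infinite D] : m.hull ∅ = ∅ := by
  have := m.infinite_edge
  simp [hull, component_empty, Set.finite_univ_iff, not_finite_iff_infinite.2 this]

/-- A component of the complement of a nonempty set contains an edge touching this set. -/
lemma exists_mem_component_touch {S : Set m.Edge} {e s : m.Edge} (he : e ∉ S) (hs : s ∈ S) :
    ∃ x ∈ m.component S e, ∃ y ∈ S, m.Touch x y := by
  by_contra! hcon
  have key : ∀ x, x ∈ m.component S e := by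
    intro x
    induction m.reflTransGen_touch e x with
    | refl => exact m.self_mem_component S e
    | @tail b c _ hbc ih =>
      by_cases hc : c ∈ S
      · exact absurd hbc (hcon b ih c hc)
      · exact Relation.ReflTransGen.tail ih ⟨m.notMem_of_mem_component he ih, hc, hbc⟩
  exact m.notMem_of_mem_component he (key s) hs

lemma LocallyFinite.finite_setOf_touch {m : RootedMap D} (hloc : m.LocallyFinite) (a : m.Edge) :
    {b | m.Touch b a}.Finite := by
  have : (⋃ d' ∈ {d' | m.edge d' = a}, m.edge '' {d | m.vert d = m.vert d'}).Finite :=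
    (m.finite_setOf_edge_eq a).biUnion fun d' _ => (hloc.1 _).image _
  refine this.subset ?_
  rintro b ⟨d, d', rfl, h2, h3⟩
  exact Set.mem_biUnion h2 ⟨d, h3, rfl⟩

/-- Each filled component is finite and contains an edge touching `S`; by local finiteness only
finitely many edges touch `S`, so finitely many components are filled. -/
lemma LocallyFinite.finite_hull [Infinite D] {m : RootedMap D} (hloc : m.LocallyFinite)
    {S : Set m.Edge} (hS : S.Finite) : (m.hull S).Finite := by
  rcases S.eq_empty_or_nonempty with rfl | ⟨s, hs⟩
  · rw [hull_empty]; exact Set.finite_empty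
  refine hS.union ?_
  have h1 : (⋃ y ∈ S, {x | m.Touch x y}).Finite := hS.biUnion fun y _ => hloc.finite_setOf_touch y
  have h2 : (⋃ x ∈ {x ∈ ⋃ y ∈ S, {x | m.Touch x y} | (m.component S x).Finite},
      m.component S x).Finite := (h1.subset fun x hx => hx.1).biUnion fun x hx => hx.2
  refine h2.subset ?_
  rintro e ⟨he, hfin⟩
  obtain ⟨x, hx, y, hy, hxy⟩ := m.exists_mem_component_touch he hs
  refine Set.mem_biUnion (x := x) ⟨Set.mem_biUnion hy hxy, ?_⟩ (m.component_symm hx)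
  rwa [m.component_eq hx]

/-! ### Explored faces and boundaries -/

variable {m}

lemma Explored.mono {S S' : Set m.Edge} (h : S ⊆ S') {f : m.Face} (hf : m.Explored S f) :
    m.Explored S' f :=
  hf.imp_right fun ⟨d, hd, hd'⟩ => ⟨d, hd, h hd'⟩

variable (m) in
lemma explored_rootFace (S : Set m.Edge) : m.Explored S m.rootFace := Or.inl rfl

lemma explored_of_mem {S : Set m.Edge} {d : D} (h : m.edge d ∈ S) : m.Explored S (m.face d) :=
  Or.inr ⟨d, rfl, h⟩

lemma explored_empty_iff {f : m.Face} : m.Explored ∅ f ↔ f = m.rootFace := by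
  simp [Explored]

variable (m) in
/-- Consecutive edges along a face share a vertex. -/
lemma touch_face_step (d : D) : m.Touch (m.edge d) (m.edge ((m.rot * m.rev) d)) :=
  ⟨m.rev d, _, m.edge_rev d, rfl, (m.vert_rot _).symm⟩

/-- Walk around the face: consecutive edges share a vertex, and none of them lies in `S`. -/
lemma mem_component_of_face_eq {S : Set m.Edge} {d d' : D} (h : m.face d = m.face d')
    (hS : ∀ x, m.face x = m.face d → m.edge x ∉ S) : m.edge d' ∈ m.component S (m.edge d) := by
  have hface : ∀ x, m.face ((m.rot * m.rev) x) = m.face x := fun x => by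
    rw [Equiv.Perm.mul_apply, face_rot, m.rev_rev]
  obtain ⟨k, rfl⟩ : (m.rot * m.rev).SameCycle d d' := Quotient.exact h
  clear h
  have hk : ∀ k : ℤ, m.face (((m.rot * m.rev) ^ k) d) = m.face d := fun k =>
    (Quotient.sound (⟨k, rfl⟩ : (m.rot * m.rev).SameCycle d _)).symm
  induction k with
  | zero => exact m.self_mem_component _ _
  | succ n ih =>
    refine Relation.ReflTransGen.tail ih ⟨hS _ (hk _), hS _ (hk _), ?_⟩
    rw [add_comm, zpow_add, zpow_one]
    exact m.touch_face_step _
  | pred n ih =>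
    refine Relation.ReflTransGen.tail ih ⟨hS _ (hk _), hS _ (hk _), Touch.symm m ?_⟩
    have := m.touch_face_step (((m.rot * m.rev) ^ (-(n : ℤ) - 1)) d)
    rw [← Equiv.Perm.mul_apply, ← zpow_one_add, add_sub_cancel] at this
    exact this

/-- A face of the hull with an edge outside of the hull is a face of the submap itself. -/
lemma Explored.of_hull {S : Set m.Edge} {d : D} (h : m.Explored (m.hull S) (m.face d))
    (hd : m.edge d ∉ m.hull S) : m.Explored S (m.face d) := by
  rcases h with h | ⟨d', hd', h'⟩
  · exact Or.inl h
  by_contra hcon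
  have hS : ∀ x, m.face x = m.face d → m.edge x ∉ S :=
    fun x hx hxS => hcon (Or.inr ⟨x, hx, hxS⟩)
  rcases h' with h' | ⟨h1, h2⟩
  · exact hS d' hd' h'
  · have := mem_component_of_face_eq hd'.symm hS
    rw [m.component_eq this] at h2
    -- The face has no edge in `S`, so all its edges lie in one component; this component was
    -- filled, and it contains the edge of `d`.
    exact hd (Or.inr ⟨hS d rfl, h2⟩)

lemma LocallyFinite.finite_boundary (hloc : m.LocallyFinite) {S : Set m.Edge} (hS : S.Finite) :
    (m.boundary S).Finite := by
  have h1 : (⋃ e ∈ S, {d | m.edge d = e}).Finite :=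
    hS.biUnion fun e _ => m.finite_setOf_edge_eq e
  have h2 : (⋃ f ∈ insert m.rootFace (m.face '' ⋃ e ∈ S, {d | m.edge d = e}),
      {d | m.face d = f}).Finite := ((h1.image _).insert _).biUnion fun f _ => hloc.2 f
  refine h2.subset ?_
  rintro d ⟨_, h⟩
  refine Set.mem_biUnion (x := m.face d) ?_ rfl
  rcases h with h | ⟨d', h3, h4⟩
  · exact Or.inl h
  · exact Or.inr ⟨d', Set.mem_biUnion h4 rfl, h3⟩

/-- With an empty boundary, the explored faces would be stable under crossing any of their edges; by
connectedness every face would be explored and every edge would be in the finite set `S`. -/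
lemma nonempty_boundary [Infinite D] {S : Set m.Edge} (hS : S.Finite) :
    (m.boundary S).Nonempty := by
  by_contra! hcon
  have hb : ∀ d, m.Explored S (m.face d) → m.edge d ∈ S := by
    intro d hd
    by_contra h
    have : d ∈ m.boundary S := ⟨h, hd⟩
    simp [hcon] at this
  have hrev : ∀ d, m.Explored S (m.face d) → m.Explored S (m.face (m.rev d)) := fun d hd =>
    explored_of_mem (by rw [edge_rev]; exact hb d hd)
  have hrev' : ∀ d, m.Explored S (m.face (m.rev d)) ↔ m.Explored S (m.face d) := fun d =>
    ⟨fun h => by simpa [m.rev_rev] using hrev _ h, hrev d⟩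
  have key := m.forall_of_invariant (p := fun d => m.Explored S (m.face d))
    (m.explored_rootFace S) (fun d => by rw [face_rot, hrev']) hrev'
  have := m.infinite_edge
  refine Set.infinite_univ (hS.subset fun e _ => ?_)
  obtain ⟨d, rfl⟩ := m.exists_edge_eq e
  exact hb d (key d)

lemma LocallyFinite.perimeter_pos [Infinite D] (hloc : m.LocallyFinite) {S : Set m.Edge}
    (hS : S.Finite) : 0 < m.perimeter S :=
  (Set.ncard_pos (hloc.finite_boundary hS)).2 (nonempty_boundary hS)

end RootedMap

namespace RootedMap

variable {D : Type*} (m : RootedMap D)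

/-! ### First-passage percolation with positive weights -/

section Distance

variable {m}

lemma IsDualPath.concat {f : m.Face} {l : List D} {d : D} (h : m.IsDualPath f l (m.face d)) :
    m.IsDualPath f (l ++ [d]) (m.face (m.rev d)) := by
  induction l generalizing f with
  | nil =>
    obtain rfl : f = m.face d := h
    exact ⟨rfl, rfl⟩
  | cons a l ih => exact ⟨h.1, ih h.2⟩

variable (m) in
-- Ensures that the infimum defining the distance is over a nonempty set and is not the default
-- value 0.
lemma exists_isDualPath (f : m.Face) : ∃ l, m.IsDualPath m.rootFace l f := by
  obtain ⟨d, rfl⟩ := m.exists_face_eq f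
  have key : ∀ d, (∃ l, m.IsDualPath m.rootFace l (m.face (m.rev d))) ↔
      ∃ l, m.IsDualPath m.rootFace l (m.face d) := fun d =>
    ⟨fun ⟨l, hl⟩ => ⟨_, by simpa [m.rev_rev] using hl.concat⟩, fun ⟨l, hl⟩ => ⟨_, hl.concat⟩⟩
  exact m.forall_of_invariant (p := fun d => ∃ l, m.IsDualPath m.rootFace l (m.face d))
    ⟨[], rfl⟩ (fun d => by rw [face_rot, key]) key d

variable {w : m.Edge → ℝ} (hw : ∀ e, 0 < w e)
include hw

lemma sum_weights_nonneg (l : List D) : 0 ≤ (l.map fun d => w (m.edge d)).sum :=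
  List.sum_nonneg fun x hx => by
    obtain ⟨d, _, rfl⟩ := List.mem_map.1 hx
    exact (hw _).le

lemma fppDist_le {f g : m.Face} {l : List D} (h : m.IsDualPath f l g) :
    m.fppDist w f g ≤ (l.map fun d => w (m.edge d)).sum :=
  csInf_le ⟨0, fun _ ⟨l, _, hl⟩ => hl ▸ sum_weights_nonneg hw l⟩ ⟨l, h, rfl⟩

lemma fppDist_rootFace : m.fppDist w m.rootFace m.rootFace = 0 := by
  refine le_antisymm (fppDist_le hw (l := []) rfl) (Real.sInf_nonneg ?_)
  rintro _ ⟨l, _, rfl⟩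
  exact sum_weights_nonneg hw l

omit hw in
lemma le_fppDist_rootFace {g : m.Face} {c : ℝ}
    (h : ∀ l, m.IsDualPath m.rootFace l g → c ≤ (l.map fun d => w (m.edge d)).sum) :
    c ≤ m.fppDist w m.rootFace g := by
  obtain ⟨l, hl⟩ := m.exists_isDualPath g
  refine le_csInf ⟨_, l, hl, rfl⟩ ?_
  rintro _ ⟨l, hl, rfl⟩
  exact h l hl

lemma fppDist_rev_le (d : D) : m.fppDist w m.rootFace (m.face (m.rev d)) ≤
    m.fppDist w m.rootFace (m.face d) + w (m.edge d) := by
  rw [← sub_le_iff_le_add]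
  refine le_fppDist_rootFace fun l hl => ?_
  have := fppDist_le hw hl.concat
  simp only [List.map_append, List.sum_append, List.map_cons, List.map_nil, List.sum_cons,
    List.sum_nil, add_zero] at this
  linarith

lemma fppDist_nonneg (g : m.Face) : 0 ≤ m.fppDist w m.rootFace g :=
  le_fppDist_rootFace fun l _ => sum_weights_nonneg hw l

/-- The dual of an edge is entirely explored at the time when the flows from its two ends meet. -/
lemma mem_fppBall_iff (d : D) (t : ℝ) : m.edge d ∈ m.fppBall w t ↔
    (m.fppDist w m.rootFace (m.face d) + m.fppDist w m.rootFace (m.face (m.rev d)) +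
      w (m.edge d)) / 2 ≤ t := by
  have h1 := fppDist_rev_le hw d
  have h2 := fppDist_rev_le hw (m.rev d)
  rw [m.rev_rev, edge_rev] at h2
  constructor
  · intro h
    -- The point where the two flows meet, which is the farthest one; `h1` and `h2` place it on the
    -- segment.
    have := h d rfl ((m.fppDist w m.rootFace (m.face (m.rev d)) + w (m.edge d) -
      m.fppDist w m.rootFace (m.face d)) / 2) ⟨by linarith, by linarith⟩
    rw [pointDist] at this
    rcases min_le_iff.1 this with h | h <;> linarith
  · intro h d' hd' s _
    rw [pointDist]
    by_contra! hcon
    rw [lt_min_iff] at hcon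
    rcases m.edge_eq_iff.1 hd'.symm with rfl | rfl
    · linarith
    · rw [m.rev_rev, edge_rev] at hcon
      linarith

omit hw in
lemma fppBall_mono {s t : ℝ} (h : s ≤ t) : m.fppBall w s ⊆ m.fppBall w t :=
  fun _ he d hd x hx => (he d hd x hx).trans h

lemma fppBall_zero : m.fppBall w 0 = ∅ := by
  refine Set.eq_empty_of_forall_notMem fun e he => ?_
  obtain ⟨d, rfl⟩ := m.exists_edge_eq e
  rw [mem_fppBall_iff hw] at he
  have := fppDist_nonneg hw (m.face d)
  have := fppDist_nonneg hw (m.face (m.rev d))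
  have := hw (m.edge d)
  linarith

end Distance

/-! ### The peeling dynamics -/

/-- The number of sides of the edge `e` in the boundary of the submap `A`. -/
noncomputable def sides (A : Set m.Edge) (e : m.Edge) : ℕ :=
  {d ∈ m.boundary A | m.edge d = e}.ncard

/-- If the edges outside of the submap `A` have residual weights `r` and if each boundary edge of
`A` is explored at unit speed, then `e` is the first edge to be entirely explored. -/
def IsNext (A : Set m.Edge) (r : m.Edge → ℝ) (e : m.Edge) : Prop :=
  m.sides A e ≠ 0 ∧ 0 < r e ∧ ∀ j ∉ A, j ≠ e → m.sides A j * (r e / m.sides A e) < r j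

/-- The residual weights once each boundary edge of `A` has been explored during the time needed
to complete the exploration of the edge `e`. -/
noncomputable def residual (A : Set m.Edge) (r : m.Edge → ℝ) (e : m.Edge) : m.Edge → ℝ :=
  fun j => r j - m.sides A j * (r e / m.sides A e)

variable {m}

lemma sides_eq_zero_of_mem {A : Set m.Edge} {e : m.Edge} (he : e ∈ A) : m.sides A e = 0 := by
  have : {d ∈ m.boundary A | m.edge d = e} = ∅ :=
    Set.eq_empty_of_forall_notMem fun d ⟨hd, hd'⟩ => hd.1 (hd' ▸ he)
  rw [sides, this, Set.ncard_empty]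

lemma IsNext.notMem {A : Set m.Edge} {r : m.Edge → ℝ} {e : m.Edge} (h : m.IsNext A r e) :
    e ∉ A := fun he => h.1 (sides_eq_zero_of_mem he)

open scoped Classical in
lemma sides_edge {A : Set m.Edge} {d : D} (hd : m.edge d ∉ A) :
    m.sides A (m.edge d) = (if m.Explored A (m.face d) then 1 else 0) +
      if m.Explored A (m.face (m.rev d)) then 1 else 0 := by
  have h1 : {d' ∈ m.boundary A | m.edge d' = m.edge d} =
      (({d, m.rev d} : Finset D).filter fun d' => m.Explored A (m.face d') : Finset D) := by
    ext d'
    simp only [Finset.coe_filter, Finset.mem_insert, Finset.mem_singleton, Set.mem_ofPred_eq,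
      boundary]
    rw [← m.edge_eq_iff, eq_comm (a := m.edge d)]
    constructor
    · rintro ⟨⟨_, h⟩, h'⟩; exact ⟨h', h⟩
    · rintro ⟨h', h⟩; exact ⟨⟨h' ▸ hd, h⟩, h'⟩
  rw [sides, h1, Set.ncard_coe_finset, Finset.card_filter, Finset.sum_pair (m.rev_ne d).symm]

/-- After `i` jumps, at time `T`, the hull is `A` and the unexplored parts of the dual edges
outside of `A` have lengths `r`. -/
structure IsState (w : m.Edge → ℝ) (i : ℕ) (A : Set m.Edge) (T : ℝ) (r : m.Edge → ℝ) : Prop where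
  jumpTime_eq : m.jumpTime w i = T
  hull_eq : m.fppHull w T = A
  /-- The residual weights when both ends of an edge are explored. -/
  two : ∀ d, m.edge d ∉ A → m.Explored A (m.face d) → m.Explored A (m.face (m.rev d)) →
    r (m.edge d) = w (m.edge d) - (T - m.fppDist w m.rootFace (m.face d)) -
      (T - m.fppDist w m.rootFace (m.face (m.rev d)))
  /-- The residual weights when only one end of an edge is explored. -/
  one : ∀ d, m.edge d ∉ A → m.Explored A (m.face d) → ¬ m.Explored A (m.face (m.rev d)) →
    r (m.edge d) = w (m.edge d) - (T - m.fppDist w m.rootFace (m.face d))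
  /-- The residual weights when no end of an edge is explored. -/
  none : ∀ d, m.edge d ∉ A → ¬ m.Explored A (m.face d) → ¬ m.Explored A (m.face (m.rev d)) →
    r (m.edge d) = w (m.edge d)

namespace IsState

variable {w : m.Edge → ℝ} {i : ℕ} {A : Set m.Edge} {T : ℝ} {r : m.Edge → ℝ}

lemma jumpHull_eq (h : IsState w i A T r) : m.jumpHull w i = A := by
  rw [jumpHull, h.jumpTime_eq, h.hull_eq]

lemma zero [Infinite D] (hw : ∀ e, 0 < w e) : IsState w 0 (∅ : Set m.Edge) 0 w where
  jumpTime_eq := rfl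
  hull_eq := by rw [fppHull, fppBall_zero hw, hull_empty]
  two d _ h1 h2 := by
    rw [explored_empty_iff] at h1 h2
    rw [h1, h2, fppDist_rootFace hw]; ring
  one d _ h1 _ := by
    rw [explored_empty_iff] at h1
    rw [h1, fppDist_rootFace hw]; ring
  none _ _ _ _ := rfl

/-- As long as no edge outside of the hull has been entirely explored, no face outside of the hull
has been reached. -/
lemma le_fppDist (h : IsState w i A T r) (hw : ∀ e, 0 < w e) {δ : ℝ}
    (hδ : ∀ j ∉ A, m.sides A j * δ ≤ r j) {g : m.Face} (hg : ¬ m.Explored A g) :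
    T + δ ≤ m.fppDist w m.rootFace g := by
  -- Follow the path up to its first exit from the explored faces. The exit edge has exactly one
  -- explored end, so its weight is `r` plus the length `T - dist` already explored, and `r` is at
  -- least `δ`.
  have key : ∀ (l : List D) (f : m.Face), m.Explored A f → m.IsDualPath f l g →
      T + δ ≤ m.fppDist w m.rootFace f + (l.map fun d => w (m.edge d)).sum := by
    intro l
    induction l with
    | nil =>
      rintro f hf rfl
      exact absurd hf hg
    | cons d l ih =>
      rintro _ hf ⟨rfl, hl⟩
      rw [List.map_cons, List.sum_cons]
      by_cases hf' : m.Explored A (m.face (m.rev d))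
      · have h1 := ih _ hf' hl
        have h2 := fppDist_rev_le hw d
        linarith
      · have hd : m.edge d ∉ A := fun hd => hf' (explored_of_mem (by rwa [edge_rev]))
        have h1 := hδ _ hd
        rw [sides_edge hd, if_pos hf, if_neg hf', h.one d hd hf hf'] at h1
        have h2 := sum_weights_nonneg hw l
        push_cast at h1
        linarith
  refine le_fppDist_rootFace fun l hl => ?_
  have := key l _ (m.explored_rootFace A) hl
  rwa [fppDist_rootFace hw, zero_add] at this

variable {e : m.Edge} (h : IsState w i A T r) (hw : ∀ e, 0 < w e) (he : m.IsNext A r e)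
include h hw he

omit h hw in
lemma sides_mul_le : ∀ j ∉ A, m.sides A j * (r e / m.sides A e) ≤ r j := by
  intro j hj
  by_cases hje : j = e
  · subst hje
    have : (m.sides A j : ℝ) ≠ 0 := by exact_mod_cast he.1
    rw [mul_div_cancel₀ _ this]
  · exact (he.2.2 j hj hje).le

/-- An edge with a single explored end is crossed exactly when its exploration is completed. -/
lemma fppDist_rev_eq {d : D} (hd : m.edge d = e) (h1 : m.Explored A (m.face d))
    (h2 : ¬ m.Explored A (m.face (m.rev d))) :
    m.fppDist w m.rootFace (m.face (m.rev d)) = T + r e / m.sides A e := by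
  refine le_antisymm ?_ (h.le_fppDist hw (sides_mul_le he) h2)
  have hdA : m.edge d ∉ A := hd ▸ he.notMem
  have h3 := h.one d hdA h1 h2
  have h4 := fppDist_rev_le hw d
  rw [← hd, sides_edge hdA, if_pos h1, if_neg h2]
  push_cast
  linarith

/-- The completion time of `j` is the one of `mem_fppBall_iff`. With two explored ends it is `T + r
j / 2`; with one, it is the average of `T + r j` and the distance to the far end, which is at least
`T + δ`; with none, both ends are at distance at least `T + δ` and the edge still has positive
length. -/
lemma mem_fppBall_iff_of_notMem {j : m.Edge} (hj : j ∉ A) {t : ℝ} (ht : t ≤ T + r e / m.sides A e) :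
    j ∈ m.fppBall w t ↔ j = e ∧ t = T + r e / m.sides A e := by
  have hadm := sides_mul_le he
  set δ := r e / m.sides A e with hδ
  obtain ⟨d, rfl⟩ := m.exists_edge_eq j
  have hej : m.edge d = e → r (m.edge d) = m.sides A (m.edge d) * δ := by
    rintro rfl
    have : (m.sides A (m.edge d) : ℝ) ≠ 0 := by exact_mod_cast he.1
    rw [hδ, mul_div_cancel₀ _ this]
  have hlt : m.edge d ≠ e → m.sides A (m.edge d) * δ < r (m.edge d) := he.2.2 _ hj
  have hne : m.edge d = e → m.sides A (m.edge d) ≠ 0 := fun h => h ▸ he.1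
  rw [mem_fppBall_iff hw]
  rw [sides_edge hj] at hej hlt hne
  have hj' : m.edge (m.rev d) ∉ A := by rwa [edge_rev]
  by_cases h1 : m.Explored A (m.face d) <;> by_cases h2 : m.Explored A (m.face (m.rev d))
  · have h3 := h.two d hj h1 h2
    simp only [if_pos h1, if_pos h2] at hej hlt hne
    push_cast at hej hlt
    by_cases hde : m.edge d = e
    · have := hej hde
      simp only [hde, true_and] at *
      constructor <;> intro <;> linarith
    · have := hlt hde
      simp only [hde, false_and, iff_false]
      linarith
  · have h3 := h.one d hj h1 h2
    have h4 := h.le_fppDist hw hadm h2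
    simp only [if_pos h1, if_neg h2] at hej hlt hne
    push_cast at hej hlt
    by_cases hde : m.edge d = e
    · have := hej hde
      have h5 := fppDist_rev_eq h hw he hde h1 h2
      simp only [hde, true_and] at *
      constructor <;> intro <;> linarith
    · have := hlt hde
      simp only [hde, false_and, iff_false]
      linarith
  · have h3 := h.one (m.rev d) hj' h2 (by rwa [m.rev_rev])
    rw [edge_rev] at h3
    have h4 := h.le_fppDist hw hadm h1
    simp only [if_pos h2, if_neg h1] at hej hlt hne
    push_cast at hej hlt
    by_cases hde : m.edge d = e
    · have := hej hde
      have h5 := fppDist_rev_eq h hw he (d := m.rev d) (by rwa [edge_rev]) h2 (by rwa [m.rev_rev])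
      rw [m.rev_rev] at h5
      simp only [hde, true_and] at *
      constructor <;> intro <;> linarith
    · have := hlt hde
      simp only [hde, false_and, iff_false]
      linarith
  · have h3 := h.le_fppDist hw hadm h1
    have h4 := h.le_fppDist hw hadm h2
    have h5 := hw (m.edge d)
    have hde : m.edge d ≠ e := fun hde => hne hde (by simp [h1, h2])
    simp only [hde, false_and, iff_false]
    linarith

omit h hw in
lemma waiting_pos : 0 < r e / m.sides A e :=
  div_pos he.2.1 (by exact_mod_cast Nat.pos_of_ne_zero he.1)

lemma fppHull_eq_of_lt {t : ℝ} (hT : T ≤ t) (ht : t < T + r e / m.sides A e) :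
    m.fppHull w t = A := by
  rw [← h.hull_eq]
  refine m.hull_eq_of_subset_of_subset (fppBall_mono hT) fun j hj => ?_
  by_contra hjA
  rw [← fppHull, h.hull_eq] at hjA
  exact ht.ne ((mem_fppBall_iff_of_notMem h hw he hjA ht.le).1 hj).2

lemma fppHull_next : m.fppHull w (T + r e / m.sides A e) = m.hull (insert e A) := by
  have hpos := waiting_pos he
  have hA : A = m.hull (m.fppBall w T) := h.hull_eq.symm
  have hmem := (mem_fppBall_iff_of_notMem h hw he he.notMem le_rfl).2 ⟨rfl, rfl⟩
  conv_rhs => rw [hA, hull_insert_hull]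
  refine m.hull_eq_of_subset_of_subset
    (Set.insert_subset hmem (fppBall_mono (by linarith))) fun j hj => ?_
  rw [← hull_insert_hull, ← hA]
  by_cases hjA : j ∈ A
  · exact m.subset_hull _ (Set.mem_insert_of_mem _ hjA)
  · rw [((mem_fppBall_iff_of_notMem h hw he hjA le_rfl).1 hj).1]
    exact m.subset_hull _ (Set.mem_insert _ _)

lemma jumpTime_succ : m.jumpTime w (i + 1) = T + r e / m.sides A e := by
  have hpos := waiting_pos he
  -- Once completed, `e` stays in the ball, so the hull differs from `A` at all later times and the
  -- infimum is attained.
  have hset : {t | m.jumpTime w i < t ∧ m.fppHull w t ≠ m.fppHull w (m.jumpTime w i)} =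
      Set.Ici (T + r e / m.sides A e) := by
    ext t
    rw [h.jumpTime_eq, h.hull_eq, Set.mem_ofPred_eq, Set.mem_Ici]
    refine ⟨fun ⟨h1, h2⟩ => ?_, fun ht => ⟨by linarith, fun hA => he.notMem ?_⟩⟩
    · by_contra! hlt
      exact h2 (fppHull_eq_of_lt h hw he h1.le hlt)
    · rw [← hA]
      refine m.subset_hull _ (fppBall_mono ht ?_)
      exact (mem_fppBall_iff_of_notMem h hw he he.notMem le_rfl).2 ⟨rfl, rfl⟩
  rw [jumpTime, hset, csInf_Ici]

lemma next : IsState w (i + 1) (m.hull (insert e A)) (T + r e / m.sides A e)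
    (m.residual A r e) := by
  have hsub : A ⊆ m.hull (insert e A) :=
    (Set.subset_insert _ _).trans (m.subset_hull _)
  -- explored faces on the boundary of the new hull
  have hface : ∀ d, m.edge d ∉ m.hull (insert e A) →
      m.Explored (m.hull (insert e A)) (m.face d) → m.Explored A (m.face d) ∨
      m.fppDist w m.rootFace (m.face d) = T + r e / m.sides A e := by
    intro d hd hexp
    rcases hexp.of_hull hd with hroot | ⟨d', hd', hd'e | hd'A⟩
    · exact Or.inl (Or.inl hroot)
    · by_cases h1 : m.Explored A (m.face d)
      · exact Or.inl h1
      · refine Or.inr ?_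
        rw [← hd'] at h1 ⊢
        have h2 : m.Explored A (m.face (m.rev d')) := by
          by_contra h2
          apply he.1
          rw [← hd'e, sides_edge (hd'e ▸ he.notMem), if_neg h1, if_neg h2]
        have := fppDist_rev_eq h hw he (d := m.rev d') (by rwa [edge_rev]) h2 (by rwa [m.rev_rev])
        rwa [m.rev_rev] at this
    · exact Or.inl (Or.inr ⟨d', hd', hd'A⟩)
  have hres : ∀ d, m.edge d ∉ A → m.residual A r e (m.edge d) =
      r (m.edge d) - m.sides A (m.edge d) * (r e / m.sides A e) := fun d _ => rfl
  refine ⟨jumpTime_succ h hw he, fppHull_next h hw he, ?_, ?_, ?_⟩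
  · intro d hd h1 h2
    have hdA : m.edge d ∉ A := fun h' => hd (hsub h')
    have hd' : m.edge (m.rev d) ∉ m.hull (insert e A) := by rwa [edge_rev]
    have hdA' : m.edge (m.rev d) ∉ A := by rwa [edge_rev]
    rw [hres d hdA, sides_edge hdA]
    -- An end explored only now was reached exactly at the new time, so nothing has been consumed
    -- from it; an end explored before contributes one unit of speed.
    by_cases h3 : m.Explored A (m.face d) <;> by_cases h4 : m.Explored A (m.face (m.rev d))
    · rw [h.two d hdA h3 h4, if_pos h3, if_pos h4]; push_cast; ring
    · rw [h.one d hdA h3 h4, if_pos h3, if_neg h4, (hface _ hd' h2).resolve_left h4]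
      push_cast; ring
    · have := h.one _ hdA' h4 (by rwa [m.rev_rev])
      rw [edge_rev] at this
      rw [this, if_pos h4, if_neg h3, (hface _ hd h1).resolve_left h3]
      push_cast; ring
    · rw [h.none d hdA h3 h4, if_neg h3, if_neg h4, (hface _ hd h1).resolve_left h3,
        (hface _ hd' h2).resolve_left h4]
      push_cast; ring
  · intro d hd h1 h2
    have hdA : m.edge d ∉ A := fun h' => hd (hsub h')
    have h4 : ¬ m.Explored A (m.face (m.rev d)) := fun h' => h2 (h'.mono hsub)
    rw [hres d hdA, sides_edge hdA, if_neg h4]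
    by_cases h3 : m.Explored A (m.face d)
    · rw [h.one d hdA h3 h4, if_pos h3]; push_cast; ring
    · rw [h.none d hdA h3 h4, if_neg h3, (hface _ hd h1).resolve_left h3]; push_cast; ring
  · intro d hd h1 h2
    have hdA : m.edge d ∉ A := fun h' => hd (hsub h')
    have h3 : ¬ m.Explored A (m.face d) := fun h' => h1 (h'.mono hsub)
    have h4 : ¬ m.Explored A (m.face (m.rev d)) := fun h' => h2 (h'.mono hsub)
    rw [hres d hdA, sides_edge hdA, if_neg h3, if_neg h4, h.none d hdA h3 h4]
    push_cast; ring

end IsState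

end RootedMap

/-! ### Exponential variables -/

namespace ExponentialClocks

lemma lintegral_expMeasure (k : ℝ) {f : ℝ → ENNReal} (hf : Measurable f) :
    ∫⁻ x, f x ∂(expMeasure k) =
      ∫⁻ x in Set.Ioi 0, ENNReal.ofReal (k * Real.exp (-(k * x))) * f x := by
  have h1 : expMeasure k = volume.withDensity (exponentialPDF k) := rfl
  have h2 : Measurable (exponentialPDF k) := (measurable_exponentialPDFReal k).ennreal_ofReal
  rw [h1, lintegral_withDensity_eq_lintegral_mul _ h2 hf, ← setLIntegral_congr Ioi_ae_eq_Ici.symm,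
    ← lintegral_indicator measurableSet_Ici]
  refine lintegral_congr fun x => ?_
  rw [Pi.mul_apply]
  by_cases hx : 0 ≤ x
  · rw [Set.indicator_of_mem (by exact hx), exponentialPDF_of_nonneg hx]
  · rw [Set.indicator_of_notMem (by exact hx), exponentialPDF_of_neg (by linarith), zero_mul]

instance : IsProbabilityMeasure (expMeasure 1) := isProbabilityMeasure_expMeasure one_pos

lemma expMeasure_Ioi_zero : expMeasure 1 (Set.Ioi 0) = 1 := by
  have h := lintegral_expMeasure 1 (f := Set.indicator (Set.Ioi 0) 1)
    (measurable_one.indicator measurableSet_Ioi)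
  have h' := lintegral_expMeasure 1 (f := 1) measurable_one
  rw [lintegral_indicator_one measurableSet_Ioi] at h
  rw [h, ← measure_univ (μ := expMeasure 1), ← lintegral_one]
  refine Eq.trans (setLIntegral_congr_fun measurableSet_Ioi fun x hx => ?_) h'.symm
  rw [Set.indicator_of_mem hx]

/-- Lack of memory of the exponential distribution. -/
lemma expMeasure_shift {c : ℝ} (hc : 0 ≤ c) {S : Set ℝ} (hS : MeasurableSet S) :
    expMeasure 1 {x | c < x ∧ x - c ∈ S} = ENNReal.ofReal (Real.exp (-c)) * expMeasure 1 S := by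
  have hm : MeasurableSet {x : ℝ | c < x ∧ x - c ∈ S} :=
    measurableSet_Ioi.inter ((measurable_id.sub_const c) hS)
  rw [← lintegral_indicator_one hm, ← lintegral_indicator_one hS,
    lintegral_expMeasure 1 (measurable_one.indicator hm),
    lintegral_expMeasure 1 (measurable_one.indicator hS),
    ← lintegral_indicator measurableSet_Ioi, ← lintegral_indicator measurableSet_Ioi,
    ← lintegral_const_mul' _ _ ENNReal.ofReal_ne_top]
  refine Eq.trans (lintegral_congr fun x => ?_) (lintegral_sub_right_eq_self _ c)
  by_cases h : c < x ∧ x - c ∈ S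
  · rw [Set.indicator_of_mem (by exact hc.trans_lt h.1), Set.indicator_of_mem (by exact h),
      Set.indicator_of_mem (by exact sub_pos.2 h.1), Set.indicator_of_mem (by exact h.2),
      Pi.one_apply, Pi.one_apply, mul_one, mul_one, ← ENNReal.ofReal_mul (Real.exp_pos _).le]
    congr 1
    rw [one_mul, one_mul, one_mul, one_mul, ← Real.exp_add]
    ring_nf
  · have h1 : Set.indicator {x | c < x ∧ x - c ∈ S} (1 : ℝ → ENNReal) x = 0 :=
      Set.indicator_of_notMem (by exact h) _
    have h4 : Set.indicator (Set.Ioi 0) (fun x => ENNReal.ofReal (1 * Real.exp (-(1 * x))) *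
        Set.indicator {x | c < x ∧ x - c ∈ S} (1 : ℝ → ENNReal) x) x = 0 := by
      rw [Set.indicator_apply_eq_zero, h1, mul_zero]
      exact fun _ => rfl
    rw [h4]
    symm
    rw [mul_eq_zero, Set.indicator_apply_eq_zero]
    refine Or.inr fun h2 => ?_
    rw [Set.indicator_of_notMem fun h3 => h ⟨sub_pos.1 h2, h3⟩, mul_zero]

/-- Scaling of the exponential distribution. -/
lemma setLIntegral_expMeasure_scale {k C : ℝ} (hk : 0 < k) (hC : 0 < C) {B : Set ℝ}
    (hB : MeasurableSet B) :
    ∫⁻ x in {x | 0 < x ∧ x / k ∈ B}, ENNReal.ofReal (Real.exp (-((C - k) * (x / k))))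
      ∂(expMeasure 1) = ENNReal.ofReal (k / C) * expMeasure C B := by
  have hm : MeasurableSet {x : ℝ | 0 < x ∧ x / k ∈ B} :=
    measurableSet_Ioi.inter ((measurable_id.div_const k) hB)
  have hmul : ∀ f : ℝ → ENNReal, Measurable f →
      ∫⁻ x, f x = ∫⁻ x, ENNReal.ofReal k * f (k * x) := fun f hf => by
    conv_lhs => rw [← Real.smul_map_volume_mul_left hk.ne']
    rw [lintegral_smul_measure, lintegral_map hf (measurable_const_mul k), abs_of_pos hk,
      lintegral_const_mul' _ _ ENNReal.ofReal_ne_top, smul_eq_mul]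
  have hmeas : Measurable ({x : ℝ | 0 < x ∧ x / k ∈ B}.indicator fun x =>
      ENNReal.ofReal (Real.exp (-((C - k) * (x / k))))) :=
    Measurable.indicator (by fun_prop) hm
  rw [← lintegral_indicator hm, ← lintegral_indicator_one hB, lintegral_expMeasure 1 hmeas,
    lintegral_expMeasure C (measurable_one.indicator hB),
    ← lintegral_indicator measurableSet_Ioi, ← lintegral_indicator measurableSet_Ioi,
    ← lintegral_const_mul' _ _ ENNReal.ofReal_ne_top,
    hmul _ (Measurable.indicator (by fun_prop) measurableSet_Ioi)]
  refine lintegral_congr fun x => ?_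
  by_cases hx : 0 < x
  · have hkx : 0 < k * x := mul_pos hk hx
    have hdiv : k * x / k = x := mul_div_cancel_left₀ _ hk.ne'
    rw [Set.indicator_of_mem (Set.mem_Ioi.2 hkx), Set.indicator_of_mem (Set.mem_Ioi.2 hx)]
    by_cases hxB : x ∈ B
    · rw [Set.indicator_of_mem (s := {x : ℝ | 0 < x ∧ x / k ∈ B}) ⟨hkx, by rwa [hdiv]⟩, Set.indicator_of_mem hxB, hdiv,
        Pi.one_apply, mul_one, ← ENNReal.ofReal_mul (by positivity),
        ← ENNReal.ofReal_mul (by positivity), ← ENNReal.ofReal_mul (by positivity)]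
      congr 1
      rw [one_mul, one_mul, ← Real.exp_add, ← mul_assoc, div_mul_cancel₀ _ hC.ne']
      ring_nf
    · rw [Set.indicator_of_notMem (s := {x : ℝ | 0 < x ∧ x / k ∈ B})
          (fun h => hxB (by simpa [hdiv] using h.2)),
        Set.indicator_of_notMem hxB]
      simp
  · rw [Set.indicator_of_notMem (by simpa using fun h => hx (pos_of_mul_pos_right h hk.le)),
      Set.indicator_of_notMem (by exact hx)]
    simp

/-! ### Families of independent exponential clocks -/

variable {ι : Type*}

/-- The law of a family of independent exponential variables of parameter `1`. -/
noncomputable def law (ι : Type*) : Measure (ι → ℝ) := Measure.infinitePi fun _ => expMeasure 1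

instance : IsProbabilityMeasure (law ι) := by unfold law; infer_instance

lemma ae_pos [Countable ι] : ∀ᵐ r ∂(law ι), ∀ j, 0 < r j := by
  rw [ae_all_iff]
  intro j
  have h := measurePreserving_eval_infinitePi (fun _ : ι => expMeasure 1) j
  refine h.quasiMeasurePreserving.ae (p := fun x => 0 < x) ?_
  exact (prob_compl_eq_zero_iff measurableSet_Ioi).2 expMeasure_Ioi_zero

lemma measurableSet_forall_lt [Countable ι] (c : ι → ℝ) (J : Set ι) :
    MeasurableSet {r : ι → ℝ | ∀ j ∈ J, c j < r j} := by
  have : {r : ι → ℝ | ∀ j ∈ J, c j < r j} = J.pi fun j => Set.Ioi (c j) := by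
    ext; simp [Set.mem_pi]
  rw [this]
  exact MeasurableSet.pi J.to_countable fun j _ => measurableSet_Ioi

/-- Lack of memory for a family of independent exponential variables. -/
lemma law_shift [Countable ι] {c : ι → ℝ} (hc : ∀ j, 0 ≤ c j) {J : Set ι} {F : Finset ι}
    (hF : ∀ j ∉ F, c j = 0) (hJ : ∀ j ∉ J, c j = 0) {S : Set (ι → ℝ)} (hS : MeasurableSet S) :
    law ι {r | (∀ j ∈ J, c j < r j) ∧ (fun j => r j - c j) ∈ S} =
      ENNReal.ofReal (Real.exp (-∑ j ∈ F, c j)) * law ι S := by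
  classical
  have hf : Measurable fun (r : ι → ℝ) j => r j - c j := by fun_prop
  have hG := measurableSet_forall_lt c J
  set G := {r : ι → ℝ | ∀ j ∈ J, c j < r j}
  -- An infinite product measure is determined by its values on finite boxes, so it suffices to
  -- compute there the renormalised image of the restricted law.
  have key : ENNReal.ofReal (Real.exp (∑ j ∈ F, c j)) •
      ((law ι).restrict G).map (fun r j => r j - c j) = law ι := by
    refine Measure.eq_infinitePi _ fun s t ht => ?_
    -- All coordinates are almost surely positive, so the constraints outside `F` are free and the
    -- event becomes a box over the finite set `s ∪ F`.
    have h1 : (((law ι).restrict G).map fun r j => r j - c j) (Set.pi s t) =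
        law ι (Set.pi (s ∪ F : Finset ι)
          fun j => {x | c j < x ∧ x - c j ∈ if j ∈ s then t j else Set.univ}) := by
      rw [Measure.map_apply hf (MeasurableSet.pi s.countable_toSet fun j _ => ht j),
        Measure.restrict_apply (hf (MeasurableSet.pi s.countable_toSet fun j _ => ht j))]
      refine measure_congr ?_
      filter_upwards [ae_pos (ι := ι)] with r hr
      refine propext ⟨fun ⟨h1, h2⟩ j _ => ⟨?_, ?_⟩, fun h => ⟨fun j hj => ?_, fun j hj => ?_⟩⟩
      · by_cases hj : j ∈ J
        · exact h2 j hj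
        · rw [hJ j hj]; exact hr j
      · split_ifs with hj
        · exact h1 j hj
        · trivial
      · have := (h j (by simp at hj ⊢; exact Or.inl hj)).2
        rwa [if_pos (by simpa using hj)] at this
      · by_cases hj : j ∈ F
        · exact (h j (by simp [hj])).1
        · rw [hF j hj]; exact hr j
    have hu : ∀ j, MeasurableSet (if j ∈ s then t j else Set.univ) := fun j => by
      split_ifs
      exacts [ht j, .univ]
    have h2 : ∀ j, MeasurableSet {x | c j < x ∧ x - c j ∈ if j ∈ s then t j else Set.univ} :=
      fun j => measurableSet_Ioi.inter ((measurable_id.sub_const _) (hu j))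
    rw [Measure.smul_apply, h1, law, Measure.infinitePi_pi _ fun j _ => h2 j]
    have h3 : ∀ j, expMeasure 1 {x | c j < x ∧ x - c j ∈ if j ∈ s then t j else Set.univ} =
        ENNReal.ofReal (Real.exp (-c j)) * if j ∈ s then expMeasure 1 (t j) else 1 := by
      intro j
      rw [expMeasure_shift (hc j) (hu j)]
      split_ifs <;> simp
    simp_rw [h3]
    rw [Finset.prod_mul_distrib, ← ENNReal.ofReal_prod_of_nonneg fun j _ => (Real.exp_pos _).le,
      ← Real.exp_sum, Finset.sum_neg_distrib, smul_eq_mul, ← mul_assoc,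
      ← ENNReal.ofReal_mul (Real.exp_pos _).le, ← Real.exp_add,
      ← Finset.sum_subset Finset.subset_union_right (fun j _ hj => hF j hj), add_neg_cancel,
      Real.exp_zero, ENNReal.ofReal_one, one_mul]
    rw [Finset.prod_ite_mem, Finset.inter_eq_right.2 Finset.subset_union_left]
  have h4 : law ι {r | (∀ j ∈ J, c j < r j) ∧ (fun j => r j - c j) ∈ S} =
      (((law ι).restrict G).map fun r j => r j - c j) S := by
    rw [Measure.map_apply hf hS, Measure.restrict_apply (hf hS), Set.inter_comm]
    rfl
  rw [h4]
  conv_rhs => rw [← key]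
  rw [Measure.smul_apply, smul_eq_mul, ← mul_assoc, ← ENNReal.ofReal_mul (Real.exp_pos _).le,
    ← Real.exp_add, neg_add_cancel, Real.exp_zero, ENNReal.ofReal_one, one_mul]

open scoped Classical in
/-- Resampling one of the variables does not change the law of the family. -/
lemma law_resample (e : ι) :
    ((expMeasure 1).prod (law ι)).map (fun p => Function.update p.2 e p.1) = law ι := by
  have hf : Measurable fun p : ℝ × (ι → ℝ) => Function.update p.2 e p.1 := by
    refine measurable_pi_iff.2 fun j => ?_
    by_cases hj : j = e
    · subst hj; simpa using measurable_fst
    · simp only [Function.update_of_ne hj]; fun_prop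
  refine Measure.eq_infinitePi _ fun s t ht => ?_
  rw [Measure.map_apply hf (MeasurableSet.pi s.countable_toSet fun j _ => ht j)]
  have : (fun p : ℝ × (ι → ℝ) => Function.update p.2 e p.1) ⁻¹' (Set.pi s t) =
      (if e ∈ s then t e else Set.univ) ×ˢ Set.pi (s.erase e : Finset ι) t := by
    ext ⟨x, r⟩
    simp only [Set.mem_preimage, Set.mem_pi, Set.mem_prod, Finset.mem_coe, Finset.mem_erase]
    constructor
    · intro h
      refine ⟨?_, fun j hj => by simpa [hj.1] using h j hj.2⟩
      split_ifs with he
      · simpa using h e he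
      · trivial
    · rintro ⟨h1, h2⟩ j hj
      by_cases hje : j = e
      · subst hje; simpa [hj] using h1
      · simpa [hje] using h2 j ⟨hje, hj⟩
  rw [this, Measure.prod_prod, law, Measure.infinitePi_pi _ fun j _ => ht j]
  split_ifs with he
  · rw [Finset.mul_prod_erase s (fun j => expMeasure 1 (t j)) he]
  · rw [measure_univ, one_mul, Finset.erase_eq_of_notMem he]

/-- Competition between exponential clocks running at speeds `c`: the probability that the clock
`e` rings first, at a time in `B`, and that the other clocks are then in a state belonging to
`S`. -/
lemma law_first_clock [Countable ι] {c : ι → ℕ} {F : Finset ι} (hF : ∀ j ∉ F, c j = 0)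
    {A : Set ι} (hA : ∀ j ∈ A, c j = 0) {e : ι} (he : c e ≠ 0) {B : Set ℝ} (hB : MeasurableSet B)
    {S : Set (ι → ℝ)} (hS : MeasurableSet S)
    (hSe : ∀ r r' : ι → ℝ, (∀ j ≠ e, r j = r' j) → r ∈ S → r' ∈ S) :
    law ι {r | (0 < r e ∧ ∀ j ∉ A, j ≠ e → c j * (r e / c e) < r j) ∧ r e / c e ∈ B ∧
        (fun j => r j - c j * (r e / c e)) ∈ S} =
      ENNReal.ofReal (c e / (∑ j ∈ F, c j : ℕ)) * expMeasure (∑ j ∈ F, c j : ℕ) B * law ι S := by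
  classical
  set C : ℕ := ∑ j ∈ F, c j
  have heF : e ∈ F := by by_contra h; exact he (hF e h)
  have hce : (0 : ℝ) < c e := by exact_mod_cast Nat.pos_of_ne_zero he
  have hC : (0 : ℝ) < C := by
    have : c e ≤ C := Finset.single_le_sum (fun _ _ => Nat.zero_le _) heF
    exact hce.trans_le (by exact_mod_cast this)
  have hf : Measurable fun p : ℝ × (ι → ℝ) => Function.update p.2 e p.1 := by
    refine measurable_pi_iff.2 fun j => ?_
    by_cases hj : j = e
    · subst hj; simpa using measurable_fst
    · simp only [Function.update_of_ne hj]; fun_prop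
  have hms : MeasurableSet {r : ι → ℝ | (0 < r e ∧ ∀ j ∉ A, j ≠ e → c j * (r e / c e) < r j) ∧
      r e / c e ∈ B ∧ (fun j => r j - c j * (r e / c e)) ∈ S} := by
    refine .inter (.inter (measurableSet_lt measurable_const (measurable_pi_apply e)) ?_) (.inter ?_ ?_)
    · change MeasurableSet {r : ι → ℝ | ∀ j ∉ A, j ≠ e → c j * (r e / c e) < r j}
      simp only [Set.ofPred_forall]
      refine .iInter fun j => .iInter fun _ => .iInter fun _ => ?_
      exact measurableSet_lt (by fun_prop) (by fun_prop)
    · exact (show Measurable fun r : ι → ℝ => r e / c e by fun_prop) hB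
    · exact (show Measurable fun (r : ι → ℝ) j => r j - c j * (r e / c e) by fun_prop) hS
  -- Replace the coordinate `e` by an independent copy `x` and integrate over it last: for fixed `x`
  -- the waiting time `x / c e` is deterministic and `law_shift` applies.
  rw [← law_resample e, Measure.map_apply hf hms, Measure.prod_apply (hf hms), law_resample e]
  have key : ∀ x : ℝ, law ι (Prod.mk x ⁻¹' ((fun p : ℝ × (ι → ℝ) => Function.update p.2 e p.1) ⁻¹'
      {r : ι → ℝ | (0 < r e ∧ ∀ j ∉ A, j ≠ e → c j * (r e / c e) < r j) ∧
        r e / c e ∈ B ∧ (fun j => r j - c j * (r e / c e)) ∈ S})) =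
      {x : ℝ | 0 < x ∧ x / c e ∈ B}.indicator
        (fun x => ENNReal.ofReal (Real.exp (-((C - c e) * (x / c e)))) * law ι S) x := by
    intro x
    by_cases hx : 0 < x ∧ x / c e ∈ B
    · rw [Set.indicator_of_mem (by exact hx)]
      -- The coordinate `e` is not shifted: it is governed by `x`, and `hSe` says that `S` ignores
      -- it. The total shift is therefore `C - c e` times the waiting time.
      have h1 := law_shift (c := fun j => if j = e then 0 else c j * (x / c e))
        (fun j => by split_ifs; exacts [le_rfl, mul_nonneg (Nat.cast_nonneg _) (div_pos hx.1 hce).le])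
        (F := F) (J := {j | j ∉ A ∧ j ≠ e}) (fun j hj => by simp [hF j hj])
        (fun j hj => by
          by_cases hje : j = e
          · simp [hje]
          · simp only [Set.mem_ofPred_eq, not_and, not_not, hje] at hj
            rw [hA j (by by_contra h; exact hj h)]; simp) hS
      have h2 : ∑ j ∈ F, (if j = e then 0 else (c j : ℝ) * (x / c e)) = (C - c e) * (x / c e) := by
        have h3 : (C : ℝ) = ∑ j ∈ F, (c j : ℝ) := by simp [C]
        rw [← Finset.add_sum_erase F _ heF, if_pos rfl, zero_add, h3,
          ← Finset.add_sum_erase F _ heF, add_sub_cancel_left, Finset.sum_mul]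
        exact Finset.sum_congr rfl fun j hj => if_neg (Finset.ne_of_mem_erase hj)
      rw [h2] at h1
      rw [← h1]
      congr 1
      ext r
      simp only [Set.mem_preimage, Set.mem_ofPred_eq, Function.update_self]
      have h3 : (∀ j ∉ A, j ≠ e → c j * (x / c e) < Function.update r e x j) ↔
          ∀ j, j ∉ A ∧ j ≠ e → (if j = e then 0 else c j * (x / c e)) < r j := by
        refine forall_congr' fun j => ⟨fun h hj => ?_, fun h h1 h2 => ?_⟩
        · simpa [hj.2] using h hj.1 hj.2
        · simpa [h2] using h ⟨h1, h2⟩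
      rw [h3]
      simp only [hx.1, hx.2, true_and]
      refine and_congr_right fun _ => ⟨hSe _ _ fun j hj => ?_, hSe _ _ fun j hj => ?_⟩ <;> simp [hj]
    · rw [Set.indicator_of_notMem (by exact hx)]
      refine measure_mono_null (t := ∅) (fun r hr => ?_) measure_empty
      simp only [Set.mem_preimage, Set.mem_ofPred_eq, Function.update_self] at hr
      exact hx ⟨hr.1.1, hr.2.1⟩
  simp_rw [key]
  have hmB : MeasurableSet {x : ℝ | 0 < x ∧ x / c e ∈ B} :=
    measurableSet_Ioi.inter ((measurable_id.div_const _) hB)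
  rw [lintegral_indicator hmB, lintegral_mul_const _ (by fun_prop),
    setLIntegral_expMeasure_scale hce hC hB]

end ExponentialClocks

/-! ### The peeling dynamics as a competition of clocks -/

namespace RootedMap

variable {D : Type*} {m : RootedMap D}

/-! ### Finite trajectories of the peeling dynamics -/

variable (m) in
/-- The residual weights for which the first `n` steps of the peeling dynamics started at the
submap `A` are well defined, visit the sets `𝒜 0`, `𝒜 1`, ... and have durations in `B 0`, `B 1`,
... -/
def trajectory : ℕ → Set m.Edge → (ℕ → Set (Set m.Edge)) → (ℕ → Set ℝ) → Set (m.Edge → ℝ)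
  | 0, _, _, _ => Set.univ
  | n + 1, A, 𝒜, B => {r | ∃ e, m.IsNext A r e ∧ m.hull (insert e A) ∈ 𝒜 0 ∧
      r e / m.sides A e ∈ B 0 ∧ m.residual A r e ∈
        trajectory n (m.hull (insert e A)) (fun j => 𝒜 (j + 1)) (fun j => B (j + 1))}

/-- Otherwise each of the two edges would be completed strictly before the other. -/
lemma IsNext.unique {A : Set m.Edge} {r : m.Edge → ℝ} {e e' : m.Edge} (h : m.IsNext A r e)
    (h' : m.IsNext A r e') : e = e' := by
  by_contra hne
  have h1 := h.2.2 e' h'.notMem (Ne.symm hne)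
  have h2 := h'.2.2 e h.notMem hne
  have h3 : (0 : ℝ) < m.sides A e := by exact_mod_cast Nat.pos_of_ne_zero h.1
  have h4 : (0 : ℝ) < m.sides A e' := by exact_mod_cast Nat.pos_of_ne_zero h'.1
  rw [← lt_div_iff₀' h4] at h1
  rw [← lt_div_iff₀' h3] at h2
  exact lt_asymm h1 h2

lemma IsNext.congr {A : Set m.Edge} {r r' : m.Edge → ℝ} (hr : ∀ j ∉ A, r j = r' j) {e : m.Edge}
    (h : m.IsNext A r e) : m.IsNext A r' e := by
  refine ⟨h.1, hr e h.notMem ▸ h.2.1, fun j hj hje => ?_⟩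
  rw [← hr e h.notMem, ← hr j hj]
  exact h.2.2 j hj hje

variable (m) in
lemma subset_hull_insert (A : Set m.Edge) (e : m.Edge) : A ⊆ m.hull (insert e A) :=
  (Set.subset_insert _ _).trans (m.subset_hull _)

/-- The dynamics started at `A` only depends on the residual weights of the edges outside of
`A`. -/
lemma trajectory_congr {n : ℕ} {A : Set m.Edge} {𝒜 : ℕ → Set (Set m.Edge)} {B : ℕ → Set ℝ}
    {r r' : m.Edge → ℝ} (hr : ∀ j ∉ A, r j = r' j) (h : r ∈ m.trajectory n A 𝒜 B) :
    r' ∈ m.trajectory n A 𝒜 B := by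
  induction n generalizing A 𝒜 B r r' with
  | zero => trivial
  | succ n ih =>
    obtain ⟨e, he, h1, h2, h3⟩ := h
    have hre := hr e he.notMem
    refine ⟨e, he.congr hr, h1, hre ▸ h2, ih (fun j hj => ?_) h3⟩
    rw [residual, residual, hre, hr j fun hjA => hj (m.subset_hull_insert A e hjA)]

lemma measurable_residual (A : Set m.Edge) (e : m.Edge) :
    Measurable fun r => m.residual A r e := by
  unfold residual
  fun_prop

lemma measurableSet_isNext (A : Set m.Edge) (e : m.Edge) :
    MeasurableSet {r | m.IsNext A r e} := by
  have := m.countable_edge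
  have h1 : MeasurableSet {r : m.Edge → ℝ | 0 < r e} :=
    measurableSet_lt measurable_const (measurable_pi_apply e)
  refine .inter (.const _) (.inter h1 ?_)
  change MeasurableSet
    {r : m.Edge → ℝ | ∀ j ∉ A, j ≠ e → m.sides A j * (r e / m.sides A e) < r j}
  simp only [Set.ofPred_forall]
  refine .iInter fun j => .iInter fun _ => .iInter fun _ => ?_
  exact measurableSet_lt (by fun_prop) (by fun_prop)

lemma measurableSet_trajectory (n : ℕ) (A : Set m.Edge) (𝒜 : ℕ → Set (Set m.Edge))
    {B : ℕ → Set ℝ} (hB : ∀ j, MeasurableSet (B j)) : MeasurableSet (m.trajectory n A 𝒜 B) := by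
  have := m.countable_edge
  induction n generalizing A 𝒜 B with
  | zero => exact .univ
  | succ n ih =>
    rw [trajectory, Set.ofPred_exists]
    refine .iUnion fun e => .inter (measurableSet_isNext A e) (.inter (.const _) (.inter ?_ ?_))
    · exact (show Measurable fun r : m.Edge → ℝ => r e / m.sides A e by fun_prop) (hB 0)
    · exact measurable_residual A e (ih _ _ fun j => hB (j + 1))

/-! ### Probabilities of finite trajectories -/

/-- The edges having a side in the boundary of a finite submap. -/
noncomputable def LocallyFinite.boundaryEdges (hloc : m.LocallyFinite) {A : Set m.Edge}
    (hA : A.Finite) : Finset m.Edge :=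
  ((hloc.finite_boundary hA).image m.edge).toFinset

lemma LocallyFinite.sides_eq_zero (hloc : m.LocallyFinite) {A : Set m.Edge}
    (hA : A.Finite) {e : m.Edge} (he : e ∉ hloc.boundaryEdges hA) : m.sides A e = 0 := by
  have : {d ∈ m.boundary A | m.edge d = e} = ∅ := by
    refine Set.eq_empty_of_forall_notMem fun d ⟨hd, hd'⟩ => he ?_
    rw [boundaryEdges, Set.Finite.mem_toFinset]
    exact ⟨d, hd, hd'⟩
  rw [sides, this, Set.ncard_empty]

/-- Counts boundary darts edge by edge; this converts edges weighted by their speed into uniform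
boundary darts. -/
lemma LocallyFinite.sum_sides (hloc : m.LocallyFinite) {A : Set m.Edge} (hA : A.Finite)
    (p : m.Edge → Prop) [DecidablePred p] : ∑ e ∈ (hloc.boundaryEdges hA).filter p, m.sides A e =
      {d ∈ m.boundary A | p (m.edge d)}.ncard := by
  classical
  have hfin := hloc.finite_boundary hA
  have h1 : {d ∈ m.boundary A | p (m.edge d)} =
      (hfin.toFinset.filter fun d => p (m.edge d) : Finset D) := by ext; simp
  rw [h1, Set.ncard_coe_finset,
    Finset.card_eq_sum_card_fiberwise (f := m.edge) (t := (hloc.boundaryEdges hA).filter p)]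
  · refine Finset.sum_congr rfl fun e he => ?_
    have h2 : {d ∈ m.boundary A | m.edge d = e} =
        (((hfin.toFinset.filter fun d => p (m.edge d)).filter fun d => m.edge d = e :
          Finset D) : Set D) := by
      ext d
      have := (Finset.mem_filter.1 he).2
      simp only [Finset.coe_filter, Finset.mem_filter, Set.Finite.mem_toFinset, Set.mem_ofPred_eq]
      constructor
      · rintro ⟨h, rfl⟩; exact ⟨⟨h, this⟩, rfl⟩
      · rintro ⟨⟨h, _⟩, h'⟩; exact ⟨h, h'⟩
    rw [sides, h2, Set.ncard_coe_finset]
  · intro d hd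
    have hd := Finset.mem_filter.1 (Finset.mem_coe.1 hd)
    refine Finset.mem_coe.2 (Finset.mem_filter.2 ⟨?_, hd.2⟩)
    rw [boundaryEdges, Set.Finite.mem_toFinset]
    exact ⟨d, (Set.Finite.mem_toFinset _).1 hd.1, rfl⟩

lemma LocallyFinite.sum_sides_eq_perimeter (hloc : m.LocallyFinite) {A : Set m.Edge}
    (hA : A.Finite) : ∑ e ∈ hloc.boundaryEdges hA, m.sides A e = m.perimeter A := by
  classical
  have := hloc.sum_sides hA fun _ => True
  simpa [perimeter] using this

open ExponentialClocks

/-- The probability that `e` is the first edge to be entirely explored, at a time in `B`, and that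
the residual weights then satisfy a given property. -/
lemma LocallyFinite.law_isNext (hloc : m.LocallyFinite) {A : Set m.Edge} (hA : A.Finite)
    {e : m.Edge} (he : e ∈ hloc.boundaryEdges hA) {B : Set ℝ} (hB : MeasurableSet B)
    {S : Set (m.Edge → ℝ)} (hS : MeasurableSet S)
    (hSe : ∀ r r' : m.Edge → ℝ, (∀ j ≠ e, r j = r' j) → r ∈ S → r' ∈ S) :
    law m.Edge {r | m.IsNext A r e ∧ r e / m.sides A e ∈ B ∧ m.residual A r e ∈ S} =
      m.sides A e / m.perimeter A * expMeasure (m.perimeter A) B * law m.Edge S := by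
  have := m.countable_edge
  have he0 : m.sides A e ≠ 0 := by
    rw [boundaryEdges, Set.Finite.mem_toFinset] at he
    obtain ⟨d, hd, rfl⟩ := he
    have hfin : {d' ∈ m.boundary A | m.edge d' = m.edge d}.Finite :=
      (hloc.finite_boundary hA).subset fun _ h => h.1
    exact ((Set.ncard_pos hfin).2 ⟨d, hd, rfl⟩).ne'
  have h1 := law_first_clock (fun j hj => hloc.sides_eq_zero hA hj)
    (fun j hj => sides_eq_zero_of_mem hj) he0 hB hS hSe
  rw [hloc.sum_sides_eq_perimeter hA] at h1
  have hpos : (0 : ℝ) < m.perimeter A := by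
    rw [← hloc.sum_sides_eq_perimeter hA]
    exact_mod_cast (Nat.pos_of_ne_zero he0).trans_le
      (Finset.single_le_sum (fun _ _ => Nat.zero_le _) he)
  rw [ENNReal.ofReal_div_of_pos hpos, ENNReal.ofReal_natCast, ENNReal.ofReal_natCast] at h1
  rw [← h1]
  congr 1
  ext r
  exact and_congr_left fun _ => ⟨fun h => h.2, fun h => ⟨he0, h⟩⟩

open scoped Classical in
-- Split according to the first completed edge `e`. The rest of the trajectory does not look at the
-- coordinate `e`, which now lies in the hull, so `law_isNext` factorises the probability.
lemma LocallyFinite.law_trajectory_succ (hloc : m.LocallyFinite) (n : ℕ) {A : Set m.Edge}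
    (hA : A.Finite) (𝒜 : ℕ → Set (Set m.Edge)) {B : ℕ → Set ℝ} (hB : ∀ j, MeasurableSet (B j)) :
    law m.Edge (m.trajectory (n + 1) A 𝒜 B) =
      ∑ e ∈ (hloc.boundaryEdges hA).filter fun e => m.hull (insert e A) ∈ 𝒜 0,
        m.sides A e / m.perimeter A * expMeasure (m.perimeter A) (B 0) *
          law m.Edge (m.trajectory n (m.hull (insert e A)) (fun j => 𝒜 (j + 1))
            fun j => B (j + 1)) := by
  have := m.countable_edge
  set S : m.Edge → Set (m.Edge → ℝ) := fun e =>
    m.trajectory n (m.hull (insert e A)) (fun j => 𝒜 (j + 1)) fun j => B (j + 1)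
  have hS : ∀ e, MeasurableSet (S e) := fun e =>
    measurableSet_trajectory _ _ _ fun j => hB (j + 1)
  have hU : m.trajectory (n + 1) A 𝒜 B =
      ⋃ e ∈ (hloc.boundaryEdges hA).filter fun e => m.hull (insert e A) ∈ 𝒜 0,
        {r | m.IsNext A r e ∧ r e / m.sides A e ∈ B 0 ∧ m.residual A r e ∈ S e} := by
    ext r
    simp only [trajectory, Set.mem_ofPred_eq, Set.mem_iUnion, Finset.mem_filter, exists_prop]
    refine exists_congr fun e => ⟨fun ⟨h1, h2, h3, h4⟩ => ⟨⟨?_, h2⟩, h1, h3, h4⟩,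
      fun ⟨⟨_, h2⟩, h1, h3, h4⟩ => ⟨h1, h2, h3, h4⟩⟩
    by_contra he
    exact h1.1 (hloc.sides_eq_zero hA he)
  rw [hU, measure_biUnion_finset]
  · refine Finset.sum_congr rfl fun e he => ?_
    refine hloc.law_isNext hA (Finset.mem_filter.1 he).1 (hB 0) (hS e) fun r r' hr h => ?_
    refine trajectory_congr (fun j hj => hr j ?_) h
    rintro rfl
    exact hj (m.subset_hull _ (Set.mem_insert _ _))
  · intro e _ e' _ hne
    exact Set.disjoint_left.2 fun r hr hr' => hne (hr.1.unique hr'.1)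
  · intro e _
    refine .inter (measurableSet_isNext A e) (.inter ?_ ?_)
    · exact (show Measurable fun r : m.Edge → ℝ => r e / m.sides A e by fun_prop) (hB 0)
    · exact measurable_residual A e (hS e)

variable [Infinite D]

lemma LocallyFinite.finite_hull_insert (hloc : m.LocallyFinite) {A : Set m.Edge} (hA : A.Finite)
    (e : m.Edge) : (m.hull (insert e A)).Finite :=
  hloc.finite_hull (hA.insert e)

variable (m) in
/-- The probability to obtain `A'` when peeling a uniform boundary edge of `A`. -/
noncomputable def peelProb (A A' : Set m.Edge) : ENNReal :=
  {d ∈ m.boundary A | m.peel A d = A'}.ncard / m.perimeter A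

lemma LocallyFinite.isProbabilityMeasure_expMeasure_perimeter (hloc : m.LocallyFinite)
    {A : Set m.Edge} (hA : A.Finite) : IsProbabilityMeasure (expMeasure (m.perimeter A)) :=
  isProbabilityMeasure_expMeasure (by exact_mod_cast hloc.perimeter_pos hA)

/-- At each step the winning probabilities `sides A e / perimeter A` sum to 1, so a strict winner
almost surely exists. -/
lemma LocallyFinite.law_trajectory_univ (hloc : m.LocallyFinite) (n : ℕ) {A : Set m.Edge}
    (hA : A.Finite) :
    law m.Edge (m.trajectory n A (fun _ => Set.univ) fun _ => Set.univ) = 1 := by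
  classical
  induction n generalizing A with
  | zero => exact measure_univ
  | succ n ih =>
    have := hloc.isProbabilityMeasure_expMeasure_perimeter hA
    rw [hloc.law_trajectory_succ n hA _ fun _ => .univ]
    simp_rw [ih (hloc.finite_hull_insert hA _), measure_univ, mul_one]
    simp only [Set.mem_univ, Finset.filter_true, div_eq_mul_inv]
    rw [← Finset.sum_mul, ← Nat.cast_sum, hloc.sum_sides_eq_perimeter hA]
    exact ENNReal.mul_inv_cancel (by exact_mod_cast (hloc.perimeter_pos hA).ne')
      (ENNReal.natCast_ne_top _)

lemma LocallyFinite.law_trajectory (hloc : m.LocallyFinite) (n : ℕ) {A : ℕ → Set m.Edge}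
    (hA : (A 0).Finite) {B : ℕ → Set ℝ} (hB : ∀ j, MeasurableSet (B j)) :
    law m.Edge (m.trajectory n (A 0) (fun j => {A (j + 1)}) B) =
      ∏ j ∈ Finset.range n, m.peelProb (A j) (A (j + 1)) * expMeasure (m.perimeter (A j)) (B j) := by
  classical
  induction n generalizing A B with
  | zero => exact measure_univ
  | succ n ih =>
    rw [hloc.law_trajectory_succ n hA _ hB, Finset.prod_range_succ']
    simp only [Set.mem_singleton_iff]
    have h1 : ∀ e ∈ (hloc.boundaryEdges hA).filter fun e => m.hull (insert e (A 0)) = A (0 + 1),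
        m.sides (A 0) e / m.perimeter (A 0) * expMeasure (m.perimeter (A 0)) (B 0) *
          law m.Edge (m.trajectory n (m.hull (insert e (A 0))) (fun j => {A (j + 1 + 1)})
            fun j => B (j + 1)) =
        m.sides (A 0) e * ((m.perimeter (A 0) : ENNReal)⁻¹ *
          expMeasure (m.perimeter (A 0)) (B 0) * ∏ j ∈ Finset.range n,
          m.peelProb (A (j + 1)) (A (j + 1 + 1)) * expMeasure (m.perimeter (A (j + 1))) (B (j + 1))) := by
      intro e he
      have he := (Finset.mem_filter.1 he).2
      have h2 : (A 1).Finite := he ▸ hloc.finite_hull_insert hA e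
      rw [he, ih (A := fun j => A (j + 1)) h2 fun j => hB (j + 1), div_eq_mul_inv]
      ring
    -- Only edges leading to `A 1` remain and the future factor is common to them; the sum of their
    -- sides counts the boundary darts whose peeling gives `A 1`.
    rw [Finset.sum_congr rfl h1, ← Finset.sum_mul, ← Nat.cast_sum, hloc.sum_sides hA, peelProb,
      div_eq_mul_inv]
    unfold peel
    ring

/-! ### Trajectories and first-passage percolation -/

omit [Infinite D] in
-- Links the residual dynamics to the true jumps. The first conjunct says that the dynamics is well
-- defined for `n` steps; without it the jumps are not controlled.
lemma IsState.mem_trajectory_iff {w : m.Edge → ℝ} {i : ℕ} {A : Set m.Edge} {T : ℝ}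
    {r : m.Edge → ℝ} (h : IsState w i A T r) (hw : ∀ e, 0 < w e) (n : ℕ)
    (𝒜 : ℕ → Set (Set m.Edge)) (B : ℕ → Set ℝ) :
    r ∈ m.trajectory n A 𝒜 B ↔ r ∈ m.trajectory n A (fun _ => Set.univ) (fun _ => Set.univ) ∧
      ∀ j < n, m.jumpHull w (i + j + 1) ∈ 𝒜 j ∧
        m.jumpTime w (i + j + 1) - m.jumpTime w (i + j) ∈ B j := by
  induction n generalizing i A T r 𝒜 B with
  | zero => simp [trajectory]
  | succ n ih =>
    have key : ∀ e, m.IsNext A r e →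
        ((m.hull (insert e A) ∈ 𝒜 0 ∧ r e / m.sides A e ∈ B 0 ∧ m.residual A r e ∈
          m.trajectory n (m.hull (insert e A)) (fun j => 𝒜 (j + 1)) (fun j => B (j + 1))) ↔
        m.residual A r e ∈ m.trajectory n (m.hull (insert e A)) (fun _ => Set.univ)
          (fun _ => Set.univ) ∧ ∀ j < n + 1, m.jumpHull w (i + j + 1) ∈ 𝒜 j ∧
        m.jumpTime w (i + j + 1) - m.jumpTime w (i + j) ∈ B j) := by
      intro e he
      have hnext := h.next hw he
      rw [ih hnext, ← hnext.jumpHull_eq]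
      have hgap : r e / m.sides A e = m.jumpTime w (i + 1) - m.jumpTime w i := by
        rw [hnext.jumpTime_eq, h.jumpTime_eq]; ring
      rw [hgap]
      have h3 : (∀ j < n + 1, m.jumpHull w (i + j + 1) ∈ 𝒜 j ∧
          m.jumpTime w (i + j + 1) - m.jumpTime w (i + j) ∈ B j) ↔
          (m.jumpHull w (i + 1) ∈ 𝒜 0 ∧ m.jumpTime w (i + 1) - m.jumpTime w i ∈ B 0) ∧
          ∀ j < n, m.jumpHull w (i + 1 + j + 1) ∈ 𝒜 (j + 1) ∧
          m.jumpTime w (i + 1 + j + 1) - m.jumpTime w (i + 1 + j) ∈ B (j + 1) := by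
        rw [Nat.forall_lt_succ_left]
        have : ∀ j, i + 1 + j = i + (j + 1) := fun j => by omega
        simp only [this]
        rfl
      rw [h3]
      tauto
    constructor
    · rintro ⟨e, he, h'⟩
      have h1 := (key e he).1 h'
      exact ⟨⟨e, he, trivial, trivial, h1.1⟩, h1.2⟩
    · rintro ⟨⟨e, he, _, _, h'⟩, h1⟩
      exact ⟨e, he, (key e he).2 ⟨h', h1⟩⟩

omit [Infinite D] in
lemma IsState.of_mem_trajectory {w : m.Edge → ℝ} {i : ℕ} {A : Set m.Edge} {T : ℝ}
    {r : m.Edge → ℝ} (h : IsState w i A T r) (hw : ∀ e, 0 < w e) {n : ℕ}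
    (hr : r ∈ m.trajectory n A (fun _ => Set.univ) (fun _ => Set.univ)) :
    ∀ j < n, m.jumpTime w (i + j) < m.jumpTime w (i + j + 1) ∧
      ∃ d ∈ m.boundary (m.jumpHull w (i + j)),
        m.jumpHull w (i + j + 1) = m.peel (m.jumpHull w (i + j)) d := by
  induction n generalizing i A T r with
  | zero => simp
  | succ n ih =>
    obtain ⟨e, he, _, _, hr'⟩ := hr
    have hnext := h.next hw he
    rw [Nat.forall_lt_succ_left]
    refine ⟨?_, fun j hj => ?_⟩
    · rw [add_zero, hnext.jumpHull_eq, h.jumpHull_eq, hnext.jumpTime_eq, h.jumpTime_eq]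
      have hpos := IsState.waiting_pos he
      refine ⟨by linarith, ?_⟩
      have h1 : {d ∈ m.boundary A | m.edge d = e}.Nonempty := by
        by_contra! h2
        exact he.1 (by rw [sides, h2, Set.ncard_empty])
      obtain ⟨d, hd, rfl⟩ := h1
      exact ⟨d, hd, rfl⟩
    · have := ih hnext hr' j hj
      have h1 : i + 1 + j = i + (j + 1) := by omega
      rwa [h1] at this

end RootedMap

/-! ### Uniqueness of measures on pairs of sequences -/

lemma squareCylinders_univ_mem {γ : Type*} [MeasurableSpace γ] :
    Set.univ ∈ squareCylinders (fun _ : ℕ => {s : Set γ | MeasurableSet s}) :=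
  ⟨∅, fun _ => Set.univ, fun _ _ => MeasurableSet.univ, by simp⟩

lemma isPiSystem_squareCylinders_measurableSet {γ : Type*} [MeasurableSpace γ] :
    IsPiSystem (squareCylinders fun _ : ℕ => {s : Set γ | MeasurableSet s}) :=
  isPiSystem_squareCylinders (fun _ => MeasurableSpace.isPiSystem_measurableSet)
    fun _ => MeasurableSet.univ

/-- A finite measure on the product of two spaces of sequences is characterized by its values on
boxes depending on finitely many coordinates. -/
lemma MeasureTheory.Measure.ext_of_prod_boxes {α β : Type*} [MeasurableSpace α]
    [MeasurableSpace β] {ν ν' : Measure ((ℕ → α) × (ℕ → β))} [IsFiniteMeasure ν]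
    [IsFiniteMeasure ν']
    (h : ∀ (n : ℕ) (S : ℕ → Set α) (T : ℕ → Set β), (∀ j, MeasurableSet (S j)) →
      (∀ j, MeasurableSet (T j)) →
      ν {p | (∀ j ≤ n, p.1 j ∈ S j) ∧ ∀ j < n, p.2 j ∈ T j} =
        ν' {p | (∀ j ≤ n, p.1 j ∈ S j) ∧ ∀ j < n, p.2 j ∈ T j}) : ν = ν' := by
  refine ext_of_generate_finite _ (generateFrom_eq_prod generateFrom_squareCylinders
    generateFrom_squareCylinders ⟨fun _ => Set.univ, fun _ => squareCylinders_univ_mem, Set.iUnion_const _⟩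
    ⟨fun _ => Set.univ, fun _ => squareCylinders_univ_mem, Set.iUnion_const _⟩).symm
    (isPiSystem_squareCylinders_measurableSet.prod isPiSystem_squareCylinders_measurableSet) ?_ ?_
  · classical
    rintro _ ⟨_, ⟨s, S, hS, rfl⟩, _, ⟨t, T, hT, rfl⟩, rfl⟩
    -- Beyond every index of `s` and `t`; the `+ 1` is needed because the second family is
    -- constrained only for `j < n`.
    set n := s.sup id + t.sup id + 1
    have h1 := h n (fun j => if j ∈ s then S j else Set.univ)
      (fun j => if j ∈ t then T j else Set.univ)
      (fun j => by split_ifs; exacts [hS j trivial, .univ])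
      (fun j => by split_ifs; exacts [hT j trivial, .univ])
    have h2 : (s : Set ℕ).pi S ×ˢ (t : Set ℕ).pi T =
        {p | (∀ j ≤ n, p.1 j ∈ if j ∈ s then S j else Set.univ) ∧
          ∀ j < n, p.2 j ∈ if j ∈ t then T j else Set.univ} := by
      ext p
      refine ⟨fun hp => ⟨fun j _ => ?_, fun j _ => ?_⟩, fun hp => ⟨fun j hj => ?_, fun j hj => ?_⟩⟩
      · split_ifs with hj
        exacts [hp.1 j hj, trivial]
      · split_ifs with hj
        exacts [hp.2 j hj, trivial]
      · have h3 : j ≤ s.sup id := Finset.le_sup (f := id) hj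
        have h4 := hp.1 j (by omega)
        rwa [if_pos (by exact hj)] at h4
      · have h3 : j ≤ t.sup id := Finset.le_sup (f := id) hj
        have h4 := hp.2 j (by omega)
        rwa [if_pos (by exact hj)] at h4
    simp only [h2, h1]
  · simpa using h 0 (fun _ => Set.univ) (fun _ => Set.univ) (fun _ => .univ) fun _ => .univ

/-- If the terms of the first sequence almost surely belong to a countable set, it is enough to
consider boxes whose first component is a singleton. -/
lemma MeasureTheory.Measure.ext_of_prod_singleton_boxes {α β : Type*} [MeasurableSpace α]
    [MeasurableSingletonClass α]
    [MeasurableSpace β] {ν ν' : Measure ((ℕ → α) × (ℕ → β))} [IsFiniteMeasure ν]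
    [IsFiniteMeasure ν'] {K : Set α} (hK : K.Countable) (hν : ∀ᵐ p ∂ν, ∀ j, p.1 j ∈ K)
    (hν' : ∀ᵐ p ∂ν', ∀ j, p.1 j ∈ K)
    (h : ∀ (n : ℕ) (a : ℕ → α) (T : ℕ → Set β), (∀ j ≤ n, a j ∈ K) →
      (∀ j, MeasurableSet (T j)) →
      ν {p | (∀ j ≤ n, p.1 j = a j) ∧ ∀ j < n, p.2 j ∈ T j} =
        ν' {p | (∀ j ≤ n, p.1 j = a j) ∧ ∀ j < n, p.2 j ∈ T j}) : ν = ν' := by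
  refine Measure.ext_of_prod_boxes fun n S T hS hT => ?_
  have : Countable K := hK
  -- Countably many admissible prefixes with terms in `K`: up to a null set, the box is the disjoint
  -- union of the boxes `V a`.
  let I := {a : Fin (n + 1) → K // ∀ j : Fin (n + 1), (a j : α) ∈ S j}
  let V : I → Set ((ℕ → α) × (ℕ → β)) := fun a =>
    {p | (∀ j : Fin (n + 1), p.1 j = a.1 j) ∧ ∀ j < n, p.2 j ∈ T j}
  have hV : ∀ a, MeasurableSet (V a) := by
    intro a
    refine .inter ?_ ?_
    · change MeasurableSet {p : (ℕ → α) × (ℕ → β) | ∀ j : Fin (n + 1), p.1 j = a.1 j}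
      simp only [Set.ofPred_forall]
      exact .iInter fun j =>
        (show Measurable fun p : (ℕ → α) × (ℕ → β) => p.1 j by fun_prop)
          (measurableSet_singleton (a.1 j : α))
    · change MeasurableSet {p : (ℕ → α) × (ℕ → β) | ∀ j < n, p.2 j ∈ T j}
      simp only [Set.ofPred_forall]
      exact .iInter fun j => .iInter fun _ =>
        (measurable_pi_apply j).comp measurable_snd (hT j)
  have hdisj : Pairwise (Function.onFun Disjoint V) := by
    refine fun a b hab => Set.disjoint_left.2 fun p hp hp' => hab ?_
    exact Subtype.ext (funext fun j => Subtype.ext ((hp.1 j).symm.trans (hp'.1 j)))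
  have hsum : ∀ (ρ : Measure ((ℕ → α) × (ℕ → β))), (∀ᵐ p ∂ρ, ∀ j, p.1 j ∈ K) →
      ρ {p | (∀ j ≤ n, p.1 j ∈ S j) ∧ ∀ j < n, p.2 j ∈ T j} = ∑' a, ρ (V a) := by
    intro ρ hρ
    rw [← measure_iUnion hdisj hV]
    refine measure_congr ?_
    filter_upwards [hρ] with p hp
    refine propext ⟨fun h => ?_, fun h => ?_⟩
    · exact Set.mem_iUnion.2 ⟨⟨fun j => ⟨p.1 j, hp j⟩, fun j => h.1 j (Nat.lt_succ_iff.1 j.2)⟩,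
        fun j => rfl, h.2⟩
    · obtain ⟨a, ha⟩ := Set.mem_iUnion.1 h
      refine ⟨fun j hj => ?_, ha.2⟩
      have h1 := ha.1 ⟨j, Nat.lt_succ_iff.2 hj⟩
      simp only at h1
      rw [h1]
      exact a.2 ⟨j, Nat.lt_succ_iff.2 hj⟩
  rw [hsum ν hν, hsum ν' hν']
  refine tsum_congr fun a => ?_
  have hset : V a = {p | (∀ j ≤ n, p.1 j = (fun j => if hj : j < n + 1 then (a.1 ⟨j, hj⟩ : α) else
      a.1 0) j) ∧ ∀ j < n, p.2 j ∈ T j} := by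
    ext p
    refine and_congr_left fun _ => ⟨fun h j hj => ?_, fun h j => ?_⟩
    · simp only [Nat.lt_succ_iff.2 hj, dif_pos]
      exact h ⟨j, Nat.lt_succ_iff.2 hj⟩
    · have := h j (Nat.lt_succ_iff.1 j.2)
      simpa [j.2] using this
  rw [hset]
  refine h n _ T (fun j hj => ?_) hT
  simp only [Nat.lt_succ_iff.2 hj, dif_pos]
  exact (a.1 _).2

namespace RootedMap

variable {D : Type*} {m : RootedMap D}

open ExponentialClocks

/-! ### The law of the sequence of hulls and of its jump times -/

variable (m) in
/-- The sequence of the durations between the successive jump times. -/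
noncomputable def jumpGaps (w : m.Edge → ℝ) (i : ℕ) : ℝ := m.jumpTime w (i + 1) - m.jumpTime w i

variable [Infinite D] (hloc : m.LocallyFinite)
include hloc

lemma LocallyFinite.ae_mem_trajectory : ∀ᵐ w ∂(law m.Edge), ∀ n,
    w ∈ m.trajectory n ∅ (fun _ => Set.univ) fun _ => Set.univ := by
  rw [ae_all_iff]
  intro n
  have h := measurableSet_trajectory (m := m) n ∅ (fun _ => Set.univ) fun _ => .univ
  exact (mem_ae_iff_prob_eq_one h).2 (hloc.law_trajectory_univ n Set.finite_empty)

lemma LocallyFinite.ae_mem_trajectory_iff : ∀ᵐ w ∂(law m.Edge), ∀ n 𝒜 B,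
    w ∈ m.trajectory n ∅ 𝒜 B ↔
      ∀ j < n, m.jumpHull w (j + 1) ∈ 𝒜 j ∧ m.jumpGaps w j ∈ B j := by
  have := m.countable_edge
  filter_upwards [ae_pos, hloc.ae_mem_trajectory] with w hw htraj n 𝒜 B
  rw [(IsState.zero hw).mem_trajectory_iff hw n 𝒜 B]
  simp [htraj n, jumpGaps]

lemma LocallyFinite.ae_strictMono : ∀ᵐ w ∂(law m.Edge), StrictMono (m.jumpTime w) := by
  have := m.countable_edge
  filter_upwards [ae_pos, hloc.ae_mem_trajectory] with w hw htraj
  refine strictMono_nat_of_lt_succ fun n => ?_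
  have := ((IsState.zero hw).of_mem_trajectory hw (htraj (n + 1)) n (Nat.lt_succ_self n)).1
  rwa [zero_add] at this

omit hloc in
lemma jumpHull_zero {w : m.Edge → ℝ} (hw : ∀ e, 0 < w e) : m.jumpHull w 0 = ∅ :=
  (IsState.zero hw).jumpHull_eq

lemma LocallyFinite.ae_isPeeling : ∀ᵐ w ∂(law m.Edge), m.IsPeeling (m.jumpHull w) := by
  have := m.countable_edge
  filter_upwards [ae_pos, hloc.ae_mem_trajectory] with w hw htraj
  refine ⟨jumpHull_zero hw, fun n => ?_⟩
  have := ((IsState.zero hw).of_mem_trajectory hw (htraj (n + 1)) n (Nat.lt_succ_self n)).2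
  rwa [zero_add] at this

lemma LocallyFinite.finite_of_isPeeling {E : ℕ → Set m.Edge} (hE : m.IsPeeling E) (n : ℕ) :
    (E n).Finite := by
  induction n with
  | zero => rw [hE.1]; exact Set.finite_empty
  | succ n ih =>
    obtain ⟨d, _, hd⟩ := hE.2 n
    rw [hd]
    exact hloc.finite_hull_insert ih _

lemma LocallyFinite.ae_finite : ∀ᵐ w ∂(law m.Edge), ∀ n, (m.jumpHull w n).Finite :=
  hloc.ae_isPeeling.mono fun _ hw => hloc.finite_of_isPeeling hw

/-- On the almost sure event where the dynamics is well defined, an event on the `i`-th duration is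
a trajectory event constraining only the step `i`, and trajectory events are measurable. -/
lemma LocallyFinite.aemeasurable_jumpGaps : AEMeasurable m.jumpGaps (law m.Edge) := by
  refine aemeasurable_pi_iff.2 fun i => NullMeasurable.aemeasurable fun B hB => ?_
  have h := measurableSet_trajectory (m := m) (i + 1) ∅ (fun _ => Set.univ)
    (B := fun j => {x | j = i → x ∈ B}) fun j => .imp (.const _) hB
  refine h.nullMeasurableSet.congr ?_
  filter_upwards [hloc.ae_mem_trajectory_iff] with w hw
  refine propext ((hw (i + 1) (fun _ => Set.univ) fun j => {x | j = i → x ∈ B}).trans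
    ⟨fun h => (h i (Nat.lt_succ_self i)).2 rfl, ?_⟩)
  rintro h j _
  exact ⟨trivial, by rintro rfl; exact h⟩

lemma LocallyFinite.aemeasurable_jumpHull : AEMeasurable m.jumpHull (law m.Edge) := by
  have := m.countable_edge
  -- Used to pass from null measurability to almost everywhere measurability.
  have : MeasurableSpace.CountablyGenerated (Set m.Edge) :=
    inferInstanceAs (MeasurableSpace.CountablyGenerated (m.Edge → Prop))
  refine aemeasurable_pi_iff.2 fun i => ?_
  rcases i with _ | i
  · refine (aemeasurable_const (b := (∅ : Set m.Edge))).congr ?_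
    filter_upwards [ae_pos] with w hw
    exact (jumpHull_zero hw).symm
  refine NullMeasurable.aemeasurable fun 𝒜 _ => ?_
  have h := measurableSet_trajectory (m := m) (i + 1) ∅ (fun j => {A | j = i → A ∈ 𝒜})
    (B := fun _ => Set.univ) fun _ => .univ
  refine h.nullMeasurableSet.congr ?_
  filter_upwards [hloc.ae_mem_trajectory_iff] with w hw
  refine propext ((hw (i + 1) (fun j => {A | j = i → A ∈ 𝒜}) fun _ => Set.univ).trans
    ⟨fun h => (h i (Nat.lt_succ_self i)).1 rfl, ?_⟩)
  rintro h j _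
  exact ⟨by rintro rfl; exact h, trivial⟩

lemma LocallyFinite.law_jumpHull_jumpGaps (n : ℕ) {A : ℕ → Set m.Edge} (hA : A 0 = ∅)
    {B : ℕ → Set ℝ} (hB : ∀ j, MeasurableSet (B j)) :
    law m.Edge {w | (∀ j ≤ n, m.jumpHull w j = A j) ∧ ∀ j < n, m.jumpGaps w j ∈ B j} =
      ∏ j ∈ Finset.range n, m.peelProb (A j) (A (j + 1)) * expMeasure (m.perimeter (A j)) (B j) := by
  have := m.countable_edge
  rw [← hloc.law_trajectory n (hA ▸ Set.finite_empty) hB, hA]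
  refine measure_congr ?_
  filter_upwards [ae_pos, hloc.ae_mem_trajectory_iff] with w hpos hw
  refine propext (Iff.trans ?_ (hw _ _ _).symm)
  constructor
  · exact fun h j hj => ⟨h.1 (j + 1) hj, h.2 j hj⟩
  · refine fun h => ⟨fun j hj => ?_, fun j hj => (h j hj).2⟩
    rcases j with _ | j
    · rw [hA, jumpHull_zero hpos]
    · exact (h j hj).1

lemma LocallyFinite.law_jumpHull (n : ℕ) {A : ℕ → Set m.Edge} (hA : A 0 = ∅)
    (hfin : ∀ j < n, (A j).Finite) :
    law m.Edge {w | ∀ j ≤ n, m.jumpHull w j = A j} =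
      ∏ j ∈ Finset.range n, m.peelProb (A j) (A (j + 1)) := by
  have h := hloc.law_jumpHull_jumpGaps n hA (B := fun _ => Set.univ) fun _ => .univ
  simp only [Set.mem_univ, implies_true, and_true] at h
  rw [h]
  refine Finset.prod_congr rfl fun j hj => ?_
  -- Finiteness of `A j` makes its perimeter a positive rate.
  have := hloc.isProbabilityMeasure_expMeasure_perimeter (hfin j (Finset.mem_range.1 hj))
  rw [measure_univ, mul_one]

lemma LocallyFinite.law_jumpHull_jumpGaps_eq_mul (n : ℕ) {A : ℕ → Set m.Edge}
    (hfin : ∀ j < n, (A j).Finite) {B : ℕ → Set ℝ} (hB : ∀ j, MeasurableSet (B j)) :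
    law m.Edge {w | (∀ j ≤ n, m.jumpHull w j = A j) ∧ ∀ j < n, m.jumpGaps w j ∈ B j} =
      law m.Edge {w | ∀ j ≤ n, m.jumpHull w j = A j} *
        ∏ j ∈ Finset.range n, expMeasure (m.perimeter (A j)) (B j) := by
  have := m.countable_edge
  by_cases hA : A 0 = ∅
  · rw [hloc.law_jumpHull_jumpGaps n hA hB, hloc.law_jumpHull n hA hfin, Finset.prod_mul_distrib]
  · have h0 : law m.Edge {w | ∀ j ≤ n, m.jumpHull w j = A j} = 0 := by
      rw [← compl_compl {w | ∀ j ≤ n, m.jumpHull w j = A j}]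
      refine mem_ae_iff.1 ?_
      filter_upwards [ae_pos] with w hw h
      exact hA (by rw [← h 0 (Nat.zero_le n), jumpHull_zero hw])
    rw [h0, zero_mul]
    exact measure_mono_null (fun w hw => hw.1) h0

/-! ### The conditional law of the durations -/

omit hloc [Infinite D] in
variable (m) in
open scoped Classical in
/-- The exponential law whose rate is the perimeter of a submap. -/
noncomputable def gapLaw (A : Set m.Edge) : Measure ℝ :=
  if 0 < m.perimeter A ∧ A.Finite then expMeasure (m.perimeter A) else expMeasure 1

omit hloc [Infinite D] in
instance (A : Set m.Edge) : IsProbabilityMeasure (m.gapLaw A) := by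
  unfold gapLaw
  split_ifs with h
  · exact isProbabilityMeasure_expMeasure (by exact_mod_cast h.1)
  · infer_instance

lemma LocallyFinite.gapLaw_eq {A : Set m.Edge} (hA : A.Finite) :
    m.gapLaw A = expMeasure (m.perimeter A) := if_pos ⟨hloc.perimeter_pos hA, hA⟩

omit hloc [Infinite D] in
-- Thanks to the default value Exp(1), the map is constant off the countable set of finite submaps.
lemma measurable_gapLaw : Measurable m.gapLaw := by
  have := m.countable_edge
  refine (measurable_const (a := expMeasure 1)).measurable_of_countable_ne ?_
  refine Set.Countable.ofPred_finite.mono fun A hA => ?_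
  by_contra h
  exact hA (if_neg fun h' => h h'.2).symm

omit hloc [Infinite D] in
variable (m) in
/-- Given the sequence of hulls, the durations between the jump times are independent and follow
exponential laws. -/
noncomputable def gapKernel : Kernel (ℕ → Set m.Edge) (ℕ → ℝ) where
  toFun A := Measure.infinitePi fun i => m.gapLaw (A i)
  measurable' := by
    refine .measure_of_isPiSystem_of_isProbabilityMeasure generateFrom_squareCylinders.symm
      isPiSystem_squareCylinders_measurableSet ?_
    rintro _ ⟨s, t, ht, rfl⟩
    have ht : ∀ i, MeasurableSet (t i) := fun i => ht i trivial
    simp_rw [Measure.infinitePi_pi _ fun i _ => ht i]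
    refine Finset.measurable_prod _ fun i _ => ?_
    exact (Measure.measurable_coe (ht i)).comp (measurable_gapLaw.comp (measurable_pi_apply i))

omit hloc [Infinite D] in
lemma gapKernel_apply (A : ℕ → Set m.Edge) :
    m.gapKernel A = Measure.infinitePi fun i => m.gapLaw (A i) := rfl

omit hloc [Infinite D] in
instance : IsMarkovKernel m.gapKernel := ⟨fun A => by rw [gapKernel_apply]; infer_instance⟩

/-- Both sides are carried by sequences of finite submaps, so it suffices to test prescribed finite
prefixes of hulls, where the product formula separates the hulls from the durations. -/
lemma LocallyFinite.map_jumpHull_jumpGaps :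
    (law m.Edge).map (fun w => (m.jumpHull w, m.jumpGaps w)) =
      ((law m.Edge).map m.jumpHull) ⊗ₘ m.gapKernel := by
  have := m.countable_edge
  have hH := hloc.aemeasurable_jumpHull
  have hHG := hH.prodMk hloc.aemeasurable_jumpGaps
  have := Measure.isProbabilityMeasure_map hH
  have := Measure.isProbabilityMeasure_map hHG
  have hK : MeasurableSet {A : ℕ → Set m.Edge | ∀ j, (A j).Finite} := by
    rw [Set.ofPred_forall]
    exact .iInter fun j => (measurable_pi_apply j : Measurable fun A : ℕ → Set m.Edge => A j)
      MeasurableSet.setOfPred_finite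
  refine Measure.ext_of_prod_singleton_boxes (K := {A : Set m.Edge | A.Finite})
    Set.Countable.ofPred_finite ?_ ?_ fun n A B hA hB => ?_
  · exact (ae_map_iff hHG (measurable_fst hK)).2 hloc.ae_finite
  · have h1 : ∀ᵐ A ∂(law m.Edge).map m.jumpHull, ∀ j, (A j).Finite :=
      (ae_map_iff hH hK).2 hloc.ae_finite
    rw [← Measure.fst_compProd ((law m.Edge).map m.jumpHull) m.gapKernel] at h1
    exact ae_of_ae_map measurable_fst.aemeasurable h1
  have hm1 : MeasurableSet {a : ℕ → Set m.Edge | ∀ j ≤ n, a j = A j} := by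
    simp only [Set.ofPred_forall]
    exact .iInter fun j => .iInter fun _ =>
      (measurable_pi_apply j : Measurable fun a : ℕ → Set m.Edge => a j)
        (measurableSet_singleton (A j))
  have hm2 : MeasurableSet {s : ℕ → ℝ | ∀ j < n, s j ∈ B j} := by
    simp only [Set.ofPred_forall]
    exact .iInter fun j => .iInter fun _ => measurable_pi_apply j (hB j)
  have hm : {p : (ℕ → Set m.Edge) × (ℕ → ℝ) | (∀ j ≤ n, p.1 j = A j) ∧ ∀ j < n, p.2 j ∈ B j} =
      {a | ∀ j ≤ n, a j = A j} ×ˢ {s | ∀ j < n, s j ∈ B j} := rfl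
  rw [hm, Measure.map_apply_of_aemeasurable hHG (hm1.prod hm2), Measure.compProd_apply_prod hm1 hm2]
  refine (hloc.law_jumpHull_jumpGaps_eq_mul n (fun j hj => hA j hj.le) hB).trans ?_
  have h1 : ∀ a ∈ {a : ℕ → Set m.Edge | ∀ j ≤ n, a j = A j},
      m.gapKernel a {s | ∀ j < n, s j ∈ B j} =
        ∏ j ∈ Finset.range n, expMeasure (m.perimeter (A j)) (B j) := by
    intro a ha
    have h2 : {s : ℕ → ℝ | ∀ j < n, s j ∈ B j} = Set.pi (Finset.range n) B := by
      ext s; simp [Set.mem_pi]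
    rw [h2, gapKernel_apply, Measure.infinitePi_pi _ fun j _ => hB j]
    refine Finset.prod_congr rfl fun j hj => ?_
    have hj := (Finset.mem_range.1 hj).le
    rw [ha j hj, hloc.gapLaw_eq (hA j hj)]
  rw [setLIntegral_congr_fun hm1 h1, setLIntegral_const, mul_comm,
    Measure.map_apply_of_aemeasurable hH hm1]
  rfl

end RootedMap

/-! ### Transfer to weights on an arbitrary probability space -/

namespace RootedMap

variable {D : Type*} {m : RootedMap D} [Infinite D]

open ExponentialClocks

lemma LocallyFinite.isUniformPeeling (hloc : m.LocallyFinite) {Ω : Type*} [MeasurableSpace Ω]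
    {μ : Measure Ω} [IsProbabilityMeasure μ] {X : Ω → m.Edge → ℝ} (hX : Measurable X)
    (hlaw : μ.map X = law m.Edge) : m.IsUniformPeeling μ fun i ω => m.jumpHull (X ω) i := by
  have := m.countable_edge
  have hpeel : ∀ᵐ ω ∂μ, m.IsPeeling (m.jumpHull (X ω)) :=
    ae_of_ae_map hX.aemeasurable (hlaw ▸ hloc.ae_isPeeling)
  refine ⟨hpeel.mono fun ω h => ⟨h, hloc.finite_of_isPeeling h⟩, fun i A hA => ?_⟩
  have hnull : ∀ (n : ℕ) (A : ℕ → Set m.Edge),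
      NullMeasurableSet {w | ∀ j ≤ n, m.jumpHull w j = A j} (μ.map X) := by
    intro n A
    have hm : MeasurableSet {a : ℕ → Set m.Edge | ∀ j ≤ n, a j = A j} := by
      simp only [Set.ofPred_forall]
      exact .iInter fun j => .iInter fun _ =>
        (measurable_pi_apply j : Measurable fun a : ℕ → Set m.Edge => a j)
          (measurableSet_singleton (A j))
    rw [hlaw]
    exact hloc.aemeasurable_jumpHull.nullMeasurable hm
  have hμ : ∀ (n : ℕ) (A : ℕ → Set m.Edge), μ {ω | ∀ j ≤ n, m.jumpHull (X ω) j = A j} =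
      law m.Edge {w | ∀ j ≤ n, m.jumpHull w j = A j} := fun n A => by
    rw [← hlaw, Measure.map_apply₀ hX.aemeasurable (hnull n A)]
    rfl
  -- Any other past has probability zero, against `hA`.
  obtain ⟨hA0, hfin⟩ : A 0 = ∅ ∧ ∀ j ≤ i, (A j).Finite := by
    by_contra hcon
    refine hA ?_
    rw [← compl_compl {ω | ∀ j ≤ i, m.jumpHull (X ω) j = A j}]
    refine mem_ae_iff.1 ?_
    filter_upwards [hpeel] with ω hω h
    refine hcon ⟨by rw [← h 0 (Nat.zero_le i), hω.1], fun j hj => ?_⟩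
    rw [← h j hj]
    exact hloc.finite_of_isPeeling hω j
  refine ⟨hloc.finite_boundary (hfin i le_rfl), nonempty_boundary (hfin i le_rfl), fun B => ?_⟩
  have hs : NullMeasurableSet {ω | ∀ j ≤ i, m.jumpHull (X ω) j = A j} μ :=
    (hnull i A).preimage ⟨hX, Measure.AbsolutelyContinuous.rfl⟩
  -- The past followed by `B`: the two product formulas differ only by their last factor, which is
  -- the conditional probability.
  set A' : ℕ → Set m.Edge := fun j => if j ≤ i then A j else B
  have hA' : ∀ j ≤ i, A' j = A j := fun j hj => if_pos hj
  have hA'B : A' (i + 1) = B := if_neg (by omega)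
  have hinter : {ω | m.jumpHull (X ω) (i + 1) = B} ∩ {ω | ∀ j ≤ i, m.jumpHull (X ω) j = A j} =
      {ω | ∀ j ≤ i + 1, m.jumpHull (X ω) j = A' j} := by
    ext ω
    constructor
    · rintro ⟨h1, h2⟩ j hj
      rcases Nat.le_succ_iff.1 hj with hj | rfl
      · rw [hA' j hj]; exact h2 j hj
      · rw [hA'B]; exact h1
    · exact fun h => ⟨(h (i + 1) le_rfl).trans hA'B,
        fun j hj => (h j (Nat.le_succ_of_le hj)).trans (hA' j hj)⟩
  have h1 := hloc.law_jumpHull i hA0 fun j hj => hfin j hj.le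
  have h2 := hloc.law_jumpHull (i + 1) (A := A') ((hA' 0 (Nat.zero_le i)).trans hA0)
    fun j hj => by rw [hA' j (Nat.lt_succ_iff.1 hj)]; exact hfin j (Nat.lt_succ_iff.1 hj)
  have h3 : ∏ j ∈ Finset.range i, m.peelProb (A' j) (A' (j + 1)) =
      ∏ j ∈ Finset.range i, m.peelProb (A j) (A (j + 1)) :=
    Finset.prod_congr rfl fun j hj => by
      rw [hA' j (Finset.mem_range.1 hj).le, hA' (j + 1) (Finset.mem_range.1 hj)]
  rw [Finset.prod_range_succ, h3, hA' i le_rfl, hA'B, ← h1, ← hμ, ← hμ, ← hinter] at h2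
  rw [ProbabilityTheory.cond, Measure.smul_apply, Measure.restrict_apply₀' hs, h2, smul_eq_mul,
    ← mul_assoc, ENNReal.inv_mul_cancel hA (measure_ne_top _ _), one_mul, peelProb]

/-- The joint law is that of the hulls composed with `gapKernel`, and a regular conditional
distribution is almost everywhere unique. -/
lemma LocallyFinite.condDistrib_jumpGaps (hloc : m.LocallyFinite) {Ω : Type*} [MeasurableSpace Ω]
    {μ : Measure Ω} [IsProbabilityMeasure μ] {X : Ω → m.Edge → ℝ} (hX : Measurable X)
    (hlaw : μ.map X = law m.Edge) : ∀ᵐ ω ∂μ,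
      condDistrib (fun ω => m.jumpGaps (X ω)) (fun ω => m.jumpHull (X ω)) μ (m.jumpHull (X ω)) =
        Measure.infinitePi fun i => m.gapLaw (m.jumpHull (X ω) i) := by
  have hH : AEMeasurable m.jumpHull (μ.map X) := hlaw ▸ hloc.aemeasurable_jumpHull
  have hG : AEMeasurable m.jumpGaps (μ.map X) := hlaw ▸ hloc.aemeasurable_jumpGaps
  have h1 : μ.map (fun ω => (m.jumpHull (X ω), m.jumpGaps (X ω))) =
      (μ.map fun ω => m.jumpHull (X ω)) ⊗ₘ m.gapKernel := by
    have h2 := hloc.map_jumpHull_jumpGaps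
    rw [← hlaw, AEMeasurable.map_map_of_aemeasurable (hH.prodMk hG) hX.aemeasurable,
      AEMeasurable.map_map_of_aemeasurable hH hX.aemeasurable] at h2
    exact h2
  have h2 := condDistrib_ae_eq_of_measure_eq_compProd (fun ω => m.jumpHull (X ω))
    (hG.comp_measurable hX) h1
  exact ae_of_ae_map (hH.comp_measurable hX) h2

end RootedMap

theorem mainTheorem11 {D : Type*} [Infinite D] (m : RootedMap D)
    (hloc : m.LocallyFinite) (hplanar : m.Planar) (hend : m.OneEnded)
    {Ω : Type*} [MeasurableSpace Ω] (μ : Measure Ω) [IsProbabilityMeasure μ]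
    (x : m.Edge → Ω → ℝ) (hmeas : ∀ e, Measurable (x e))
    (hindep : iIndepFun x μ) (hlaw : ∀ e, μ.map (x e) = expMeasure 1) :
    let t : ℕ → Ω → ℝ := fun i ω => m.jumpTime (fun e => x e ω) i
    let E : ℕ → Ω → Set m.Edge := fun i ω => m.jumpHull (fun e => x e ω) i
    let gaps : Ω → ℕ → ℝ := fun ω i => t (i + 1) ω - t i ω
    let exploration : Ω → ℕ → Set m.Edge := fun ω i => E i ω
    AEMeasurable gaps μ ∧ AEMeasurable exploration μ ∧
    (∀ᵐ ω ∂μ, StrictMono fun i => t i ω) ∧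
    m.IsUniformPeeling μ E ∧
    (∀ᵐ ω ∂μ,
      iIndepFun (fun (i : ℕ) (s : ℕ → ℝ) => s i)
        (condDistrib gaps exploration μ (exploration ω)) ∧
      ∀ i : ℕ,
        (condDistrib gaps exploration μ (exploration ω)).map (fun s => s i) =
          expMeasure (m.perimeter (E i ω) : ℝ)) := by
  intro t E gaps exploration
  have hX : Measurable fun ω e => x e ω := measurable_pi_iff.2 hmeas
  have hXlaw : μ.map (fun ω e => x e ω) = ExponentialClocks.law m.Edge := by
    rw [hindep.map_fun_eq_infinitePi_map hmeas]
    simp_rw [hlaw]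
    rfl
  have hG : AEMeasurable m.jumpGaps (μ.map fun ω e => x e ω) :=
    hXlaw ▸ hloc.aemeasurable_jumpGaps
  have hH : AEMeasurable m.jumpHull (μ.map fun ω e => x e ω) :=
    hXlaw ▸ hloc.aemeasurable_jumpHull
  refine ⟨hG.comp_measurable hX, hH.comp_measurable hX,
    ae_of_ae_map hX.aemeasurable (hXlaw ▸ hloc.ae_strictMono),
    hloc.isUniformPeeling hX hXlaw, ?_⟩
  filter_upwards [hloc.condDistrib_jumpGaps hX hXlaw,
    ae_of_ae_map hX.aemeasurable (hXlaw ▸ hloc.ae_finite)] with ω hω hfin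
  have h : condDistrib gaps exploration μ (exploration ω) =
      Measure.infinitePi fun i => m.gapLaw (E i ω) := hω
  rw [h]
  -- The conditional law is an infinite product, so its coordinates are independent, with the
  -- factors as marginals.
  refine ⟨iIndepFun_infinitePi (X := fun _ s => s) fun _ => measurable_id, fun i => ?_⟩
  rw [Measure.infinitePi_map_eval]
  exact hloc.gapLaw_eq (hfin i)
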